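/- **Setting.** Consider a stochastic bandit with $A\ge 1$ arms played for $K\ge 2$ rounds. In round $t$ arm $a$ yields a reward with law $\nu_a$ supported in $[0,1]$, with mean $\mu_a$; put $\mu_\star=\max_a\mu_a$, $\Delta_a=\mu_\star-\mu_a$, and let $\Delta_{\min}=\min\{\Delta_a:\Delta_a>0\}$ (which is $\min_{i\ne\star}\Delta_i$ when the best arm $\star$ is unique; if all arms are optimal the term containing $\Delta_{\min}$ is read as $0$). The feedback of round $t$ (the arm and its reward) becomes available at the end of round $t+\tau_t$, where the delays $\tau_t$ are i.i.d. with values in $\mathbb N$. The pairs (reward vector of round $t$, $\tau_t$) are independent over $t$, and $\tau_t$ is independent of the rewards of round $t$. Let $d_\tau(q)=\min\{\gamma\in\mathbb N:\Pr[\tau\le\gamma]\ge q\}$. If $a_t$ is the arm pulled in round $t$, then $\operatorname{Regret}(K)=\sum_{t=1}^{K}(\mu_\star-\mu_{a_t})$. **Algorithm.** A multi-batched algorithm fixes, at the beginning of each batch and from the data of the previous batches, a sequence of arms and a stopping criterion. With delayed feedback, each batch is continued along its sequence until the feedback of rounds of this batch that has arrived satisfies the stopping criterion; this feedback is then the dataset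 of the batch, and the next batch begins. The algorithm ends after $K$ rounds. BaSE with parameter $\gamma$ and the geometric grid $t_0=0$, $t_m=\min(2^m,K)$, $1\le m\le M=\lceil\log_2K\rceil$, is the following multi-batched algorithm. Initially all arms are active. Batch $m$ stops when $t_m-t_{m-1}$ observations of the batch are available. For $m<M$, the active arms are pulled cyclically in batch $m$; at its end, let $\bar Y_i$ be the average of all rewards of arm $i$ in the datasets of batches $1,\dots,m$ and let $n$ be the smallest number of observations of an active arm in these datasets; if $n>0$, every active arm $i$ with $\max_{j\text{ active}}\bar Y_j-\bar Y_i\ge\sqrt{\gamma\log(KA)/n}$ is eliminated. In batch $M$ an active arm with the largest average reward is pulled (an arm without observations has average $0$, and ties go to the smallest index). **Statement.** For every $\gamma\ge 12$ there is a constant $C$, depending only on $\gamma$, such that, for all such $A$, $K$, reward laws and delay distributions, BaSE run with delayed feedback satisfies the following. 1. For every $q\in(0,1)$, $$\operatorname{Regret}(K)\le C\left(\frac{A\log K}{q\,\Delta_{\min}}+\frac{\log^2K}{q}+d_\tau(q)\log K\right).$$ 2. If the delays are $(v,b)$-subexponential for some $v\ge0$, $b>0$, i.e. $\mathbb E[\exp(\lambda(\tau-\mathbb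 E[\tau]))]\le\exp(\tfrac12v^2\lambda^2)$ for all $|\lambda|\le 1/b$, then $$\operatorname{Regret}(K)\le C\left(\frac{A\log K}{\Delta_{\min}}+\mathbb E[\tau]\log K\right).$$ Each of the two bounds holds for the expectation of $\operatorname{Regret}(K)$, and also for $\operatorname{Regret}(K)$ itself with probability at least $1-1/K$. -/

import Mathlib

open MeasureTheory ProbabilityTheory

noncomputable section

namespace DelayedBandit

/-! ### Multi-batched algorithms and their delayed execution -/

/-- A dataset: a finite collection of observed pairs (pulled arm, received reward). -/
abbrev Dataset (A : ℕ) : Type := Multiset (Fin A × ℝ)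

/-- The datasets collected in the completed batches, most recent batch first. -/
abbrev History (A : ℕ) : Type := List (Dataset A)

/-- A multi-batched bandit algorithm. At the beginning of a batch, and using only the data
collected in the previous batches, it fixes a sequence of arms for the batch (`arm h j` is the arm
pulled in the `j`-th round of the batch, `j = 0, 1, …`) and a stopping criterion on the dataset of
the batch. -/
structure MultiBatchedAlgorithm (A : ℕ) where
  arm : History A → ℕ → Fin A
  isDone : History A → Dataset A → Prop

/-- The state of the delayed execution before a round: the datasets of the completed batches, and
the first round of the current batch. -/
structure RunState (A : ℕ) where
  hist : History A
  start : ℕ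

namespace MultiBatchedAlgorithm

variable {A : ℕ} (alg : MultiBatchedAlgorithm A)

/-- The arm pulled in round `t` if the current batch is described by `s`. -/
def armAt (s : RunState A) (t : ℕ) : Fin A := alg.arm s.hist (t - s.start)

/-- The feedback available to the current batch at the end of round `t`. Rounds are numbered
`0, 1, 2, …`; `x j a` is the reward that arm `a` yields in round `j` and `d j` is the delay of
round `j`, whose feedback arrives at the end of round `j + d j`. Only feedback of rounds that were
played in the current batch is collected. -/
def batchData (x : ℕ → Fin A → ℝ) (d : ℕ → ℕ) (s : RunState A) (t : ℕ) : Dataset A :=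
  ((Finset.Icc s.start t).filter (fun j => j + d j ≤ t)).val.map
    (fun j => (alg.armAt s j, x j (alg.armAt s j)))

open Classical in
/-- The state before round `t` when the algorithm is run with delayed feedback: the current batch
is continued until the feedback that has arrived satisfies the stopping criterion; then the dataset
of the batch is stored and the next batch begins. -/
def state (x : ℕ → Fin A → ℝ) (d : ℕ → ℕ) : ℕ → RunState A
  | 0 => ⟨[], 0⟩
  | t + 1 =>
    let s := state x d t
    let D := alg.batchData x d s t
    if alg.isDone s.hist D then ⟨D :: s.hist, t + 1⟩ else s

/-- The arm pulled in round `t` of the run with delayed feedback. -/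
def pulledArm (x : ℕ → Fin A → ℝ) (d : ℕ → ℕ) (t : ℕ) : Fin A :=
  alg.armAt (alg.state x d t) t

end MultiBatchedAlgorithm

/-! ### The batched successive elimination (BaSE) algorithm -/

/-- The number of observed pulls of arm `i` in a dataset. -/
def count {A : ℕ} (D : Dataset A) (i : Fin A) : ℕ := (D.filter (fun o => o.1 = i)).card

/-- The average observed reward of arm `i` in a dataset (`0` if there is no observation). -/
def average {A : ℕ} (D : Dataset A) (i : Fin A) : ℝ :=
  ((D.filter (fun o => o.1 = i)).map Prod.snd).sum / (count D i : ℝ)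

/-- The number of batches of BaSE with the geometric grid of ratio two: `⌈log₂ K⌉`. -/
def numBatches (K : ℕ) : ℕ := Nat.clog 2 K

/-- The geometric grid `t_0 = 0`, `t_m = min (2 ^ m) K`. -/
def grid (K : ℕ) : ℕ → ℕ
  | 0 => 0
  | m + 1 => min (2 ^ (m + 1)) K

open Classical in
/-- The set of active arms of BaSE after the batches recorded in the history. At the end of a batch,
let `n` be the least number of observations of a currently active arm in the data of all batches.
An active arm `i` is eliminated if its average reward falls short of that of some active
arm (equivalently, of the best active average) by at least `√(γ log(K A) / n)`, where nothing is
eliminated if `n = 0`. -/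
def activeArms (A K : ℕ) (γ : ℝ) : History A → Finset (Fin A)
  | [] => Finset.univ
  | D :: h =>
    let S := activeArms A K γ h
    let data : Dataset A := (D :: h).sum
    let n : ℕ := ⨅ j : {j // j ∈ S}, count data j.1
    S.filter (fun i => ¬ (0 < n ∧ ∃ j ∈ S,
      Real.sqrt (γ * Real.log ((K : ℝ) * (A : ℝ)) / (n : ℝ)) ≤ average data j - average data i))

/-- BaSE with `A` arms, horizon `K`, the geometric grid and tuning parameter `γ`. In each batch but
the last one the active arms are pulled cyclically, in increasing order. In the last batch the
active arm with the largest average reward (the first one, in case of ties) is pulled.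
The `m`-th batch ends when `t_m - t_(m-1)` observations of the batch are available. -/
def BaSE (A K : ℕ) [NeZero A] (γ : ℝ) : MultiBatchedAlgorithm A where
  arm h j :=
    let l := (activeArms A K γ h).sort (· ≤ ·)
    if h.length + 1 < numBatches K then l.getD (j % l.length) 0
    else (l.argmax (average h.sum)).getD 0
  isDone h D := grid K (h.length + 1) - grid K h.length ≤ D.card

/-! ### The stochastic environment -/

/-- The mean reward of each arm. -/
def meanReward {A : ℕ} (ν : Fin A → Measure ℝ) (i : Fin A) : ℝ := ∫ y, y ∂(ν i)

/-- The optimality gap of arm `i`. -/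
def gap {A : ℕ} (ν : Fin A → Measure ℝ) (i : Fin A) : ℝ :=
  (⨆ j, meanReward ν j) - meanReward ν i

/-- The smallest gap of a suboptimal arm. If all arms are optimal then this is `0` by
convention, and the regret of every algorithm vanishes. -/
def minGap {A : ℕ} (ν : Fin A → Measure ℝ) : ℝ := sInf {δ : ℝ | 0 < δ ∧ ∃ i, gap ν i = δ}

/-- The quantile function of the delay distribution. -/
def delayQuantile (ρ : Measure ℕ) (q : ℝ) : ℕ := sInf {n : ℕ | q ≤ ρ.real (Set.Iic n)}

/-- The expected delay. -/
def meanDelay (ρ : Measure ℕ) : ℝ := ∫ n : ℕ, (n : ℝ) ∂ρ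

/-- `(v, b)`-subexponential delays. -/
def IsSubexponential (ρ : Measure ℕ) (v b : ℝ) : Prop :=
  0 ≤ v ∧ 0 < b ∧ ∀ l : ℝ, |l| ≤ 1 / b →
    Integrable (fun n : ℕ => Real.exp (l * ((n : ℝ) - meanDelay ρ))) ρ ∧
    ∫ n : ℕ, Real.exp (l * ((n : ℝ) - meanDelay ρ)) ∂ρ ≤ Real.exp (1 / 2 * v ^ 2 * l ^ 2)

/-- Stochastic bandit feedback with i.i.d. delays: in round `t` arm `a` yields the reward `X t a`,
with law `ν a`, and the feedback of round `t` is delayed by `T t`, with law `ρ`. The rounds are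
independent, and the delay of a round is independent of its rewards. The rewards that different
arms would yield in one and the same round need not be independent. -/
structure IsEnvironment {Ω : Type*} [MeasurableSpace Ω] (P : Measure Ω) {A : ℕ}
    (ν : Fin A → Measure ℝ) (ρ : Measure ℕ) (X : ℕ → Fin A → Ω → ℝ) (T : ℕ → Ω → ℕ) : Prop where
  measurable_reward : ∀ t a, Measurable (X t a)
  measurable_delay : ∀ t, Measurable (T t)
  law_reward : ∀ t a, P.map (X t a) = ν a
  law_delay : ∀ t, P.map (T t) = ρ
  indep_rounds : iIndepFun (fun (t : ℕ) (ω : Ω) => ((fun a => X t a ω : Fin A → ℝ), T t ω)) P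
  indep_delay : ∀ t, IndepFun (fun (ω : Ω) => (fun a => X t a ω : Fin A → ℝ)) (T t) P

/-- The regret over `K` rounds of an algorithm run with delayed feedback, as a random variable. -/
def regret {Ω : Type*} {A : ℕ} (alg : MultiBatchedAlgorithm A) (ν : Fin A → Measure ℝ)
    (X : ℕ → Fin A → Ω → ℝ) (T : ℕ → Ω → ℕ) (K : ℕ) (ω : Ω) : ℝ :=
  ∑ t ∈ Finset.range K, gap ν (alg.pulledArm (fun j a => X j a ω) (fun j => T j ω) t)

/-- A regret bound that holds in expectation and with probability at least `1 - 1 / K`. -/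
def RegretBound {Ω : Type*} [MeasurableSpace Ω] (P : Measure Ω) (R : Ω → ℝ) (K : ℕ)
    (B : ℝ) : Prop :=
  (Integrable R P ∧ ∫ ω, R ω ∂P ≤ B) ∧ 1 - 1 / (K : ℝ) ≤ P.real {ω | R ω ≤ B}

end DelayedBandit

end

noncomputable section

namespace DelayedBandit

/-! ### The delayed execution of a multi-batched algorithm -/

/-! The stopping rule of BaSE only counts observations, so the batch boundaries and the set of
observed rounds are functions of the delays alone (`BaSE_clock`). Rewards and delays can therefore
be treated separately.

Rewards: once the delays of the first K rounds are fixed, the observed rounds form a deterministic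
set and the arm of a round depends on earlier rewards only. Hoeffding's lemma yields an exponential
supermartingale, and a union bound puts all observed averages within half a confidence radius of the
means (`measure_not_rewardsConcentrated_le`). Then a best arm is never eliminated.

Arrivals: older rounds are likelier to have arrived, so in any window each residue class modulo s
receives about a share 1/s of the expected arrivals, and Chernoff bounds transfer this to the actual
arrivals (`measureReal_not_arrivalsBalanced_le`). Hence an arm of gap δ can be active only in
batches m with 2^m at most of order A(γ log(KA) + log K)/δ² (`pow_le_of_mem_activeArms`).

Clock: `potential_le` converts batch indices into time through a potential that grows in each window
by at most the arrivals plus a loss β. For the quantile bound the potential is qt/2, with loss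
q·d(q)/2 + 8 log K in each of the O(log K) batches; this is the source of log²K/q. For the mean
bound it is the number of past rounds with delay at most the median. Its loss per batch is
deterministic, at most the median, and comparing it with t/4 costs log K only once, so no log²K
appears. The median is at most twice the mean by Markov's inequality.

Summation: a pull with gap v at time t forces t ≤ H/v² + b, and such gaps sum to order b + H/Δ_min
(`sum_le_of_eq_zero_or`). If A > K, the trivial bound K on the regret suffices. -/

/-- The rounds from `σ` to `t` whose feedback has arrived at the end of round `t`. -/
def arrived (d : ℕ → ℕ) (σ t : ℕ) : Finset ℕ := (Finset.Icc σ t).filter (fun j => j + d j ≤ t)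

lemma card_arrived_le (d : ℕ → ℕ) (σ t : ℕ) : (arrived d σ t).card ≤ t + 1 - σ := by
  unfold arrived
  refine (Finset.card_filter_le _ _).trans ?_
  simp

/-- The total observed reward of arm `i` in a dataset. -/
def rewardSum {A : ℕ} (D : Dataset A) (i : Fin A) : ℝ :=
  ((D.filter (fun o => o.1 = i)).map Prod.snd).sum

lemma average_eq {A : ℕ} (D : Dataset A) (i : Fin A) :
    average D i = rewardSum D i / (count D i : ℝ) := rfl

lemma count_add {A : ℕ} (D D' : Dataset A) (i : Fin A) :
    count (D + D') i = count D i + count D' i := by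
  simp [count]

lemma rewardSum_add {A : ℕ} (D D' : Dataset A) (i : Fin A) :
    rewardSum (D + D') i = rewardSum D i + rewardSum D' i := by
  simp [rewardSum]

lemma count_map {A : ℕ} (s : Finset ℕ) (a : ℕ → Fin A) (y : ℕ → ℝ) (i : Fin A) :
    count (s.val.map (fun j => (a j, y j))) i = (s.filter (fun j => a j = i)).card := by
  simp [count, Multiset.filter_map, Finset.card_def]

lemma rewardSum_map {A : ℕ} (s : Finset ℕ) (a : ℕ → Fin A) (y : ℕ → ℝ) (i : Fin A) :
    rewardSum (s.val.map (fun j => (a j, y j))) i = ∑ j ∈ s.filter (fun j => a j = i), y j := by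
  simp [rewardSum, Multiset.filter_map, Finset.sum]

namespace MultiBatchedAlgorithm

variable {A : ℕ} (alg : MultiBatchedAlgorithm A) (x : ℕ → Fin A → ℝ) (d : ℕ → ℕ)

/-- The current batch is completed at the end of round `t`. -/
def Completes (t : ℕ) : Prop :=
  alg.isDone (alg.state x d t).hist (alg.batchData x d (alg.state x d t) t)

lemma state_succ_of_completes {t : ℕ} (h : alg.Completes x d t) :
    alg.state x d (t + 1) =
      ⟨alg.batchData x d (alg.state x d t) t :: (alg.state x d t).hist, t + 1⟩ :=
  if_pos h

lemma state_succ_of_not_completes {t : ℕ} (h : ¬ alg.Completes x d t) :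
    alg.state x d (t + 1) = alg.state x d t :=
  if_neg h

lemma start_le (t : ℕ) : (alg.state x d t).start ≤ t := by
  induction t with
  | zero => exact le_rfl
  | succ t ih =>
    by_cases h : alg.Completes x d t
    · rw [state_succ_of_completes _ _ _ h]
    · rw [state_succ_of_not_completes _ _ _ h]
      exact ih.trans t.le_succ

/-- The state changes only when a batch completes, and completion moves `start` beyond the current
round. -/
lemma state_eq_of_start_le {t j : ℕ} (h1 : (alg.state x d t).start ≤ j) (h2 : j ≤ t) :
    alg.state x d j = alg.state x d t := by
  induction t with
  | zero => rw [Nat.le_zero.1 h2]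
  | succ t ih =>
    rcases h2.eq_or_lt with rfl | h3
    · rfl
    by_cases h : alg.Completes x d t
    · rw [state_succ_of_completes _ _ _ h] at h1
      simp only at h1
      omega
    · rw [state_succ_of_not_completes _ _ _ h] at h1 ⊢
      exact ih h1 (Nat.lt_succ_iff.1 h3)

lemma not_completes_of_start_le {t : ℕ} (h1 : (alg.state x d (t + 1)).start ≤ t) :
    ¬ alg.Completes x d t := by
  intro h
  rw [state_succ_of_completes _ _ _ h] at h1
  simp only at h1
  omega

lemma pulledArm_eq_of_start_le {t j : ℕ} (h1 : (alg.state x d t).start ≤ j) (h2 : j ≤ t) :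
    alg.pulledArm x d j = alg.armAt (alg.state x d t) j := by
  rw [pulledArm, state_eq_of_start_le _ _ _ h1 h2]

lemma batchData_eq (t : ℕ) :
    alg.batchData x d (alg.state x d t) t = (arrived d (alg.state x d t).start t).val.map
      (fun j => (alg.pulledArm x d j, x j (alg.pulledArm x d j))) := by
  refine Multiset.map_congr rfl fun j hj => ?_
  have hj' : j ∈ arrived d (alg.state x d t).start t := hj
  simp only [arrived, Finset.mem_filter, Finset.mem_Icc] at hj'
  rw [alg.pulledArm_eq_of_start_le x d hj'.1.1 hj'.1.2]

lemma card_batchData (s : RunState A) (t : ℕ) :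
    (alg.batchData x d s t).card = (arrived d s.start t).card := by
  rw [batchData, Multiset.card_map]
  rfl

open Classical in
/-- The rounds whose feedback belongs to the datasets of the batches completed before round
`t`. -/
def observed : ℕ → Finset ℕ
  | 0 => ∅
  | t + 1 =>
    if alg.Completes x d t then observed t ∪ arrived d (alg.state x d t).start t else observed t

lemma observed_subset (t : ℕ) : alg.observed x d t ⊆ Finset.range (alg.state x d t).start := by
  induction t with
  | zero => simp [observed]
  | succ t ih =>
    by_cases h : alg.Completes x d t
    · rw [state_succ_of_completes _ _ _ h, observed, if_pos h]
      refine Finset.union_subset (ih.trans ?_) ?_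
      · exact Finset.range_subset_range.2 ((alg.start_le x d t).trans t.le_succ)
      · intro j hj
        simp only [arrived, Finset.mem_filter, Finset.mem_Icc] at hj
        simp only [Finset.mem_range]
        omega
    · rw [state_succ_of_not_completes _ _ _ h, observed, if_neg h]
      exact ih

/-- Completed batches occupy disjoint blocks of rounds, so the pooled data are indexed by a plain
finset of rounds. This turns averages into sums over rounds. -/
lemma sum_hist (t : ℕ) :
    (alg.state x d t).hist.sum = (alg.observed x d t).val.map
      (fun j => (alg.pulledArm x d j, x j (alg.pulledArm x d j))) := by
  induction t with
  | zero => simp [state, observed]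
  | succ t ih =>
    by_cases h : alg.Completes x d t
    · rw [state_succ_of_completes _ _ _ h, observed, if_pos h]
      have hd : Disjoint (alg.observed x d t) (arrived d (alg.state x d t).start t) := by
        rw [Finset.disjoint_left]
        intro j hj hj'
        have := alg.observed_subset x d t hj
        simp only [arrived, Finset.mem_filter, Finset.mem_Icc, Finset.mem_range] at hj' this
        omega
      rw [← Finset.disjUnion_eq_union _ _ hd]
      simp only [Finset.disjUnion_val, Multiset.map_add, List.sum_cons]
      rw [ih, batchData_eq, add_comm]
    · rw [state_succ_of_not_completes _ _ _ h, observed, if_neg h]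
      exact ih

-- Predictability: round t can influence the state only from round t + 1 on. Hence the arm of a
-- round is a function of the past, and delays of later rounds may be replaced freely.
variable {x d} in
lemma state_congr {x' : ℕ → Fin A → ℝ} {d' : ℕ → ℕ} {t : ℕ} (hx : ∀ j < t, x j = x' j)
    (hd : ∀ j < t, d j = d' j) : alg.state x d t = alg.state x' d' t := by
  induction t with
  | zero => rfl
  | succ t ih =>
    have ih' := ih (fun j hj => hx j (hj.trans t.lt_succ_self))
      (fun j hj => hd j (hj.trans t.lt_succ_self))
    have hb : alg.batchData x d (alg.state x d t) t = alg.batchData x' d' (alg.state x' d' t) t := by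
      rw [ih']
      unfold batchData
      have hf : (Finset.Icc (alg.state x' d' t).start t).filter (fun j => j + d j ≤ t)
          = (Finset.Icc (alg.state x' d' t).start t).filter (fun j => j + d' j ≤ t) := by
        refine Finset.filter_congr fun j hj => ?_
        rw [hd j (Nat.lt_succ_iff.2 (Finset.mem_Icc.1 hj).2)]
      rw [hf]
      refine Multiset.map_congr rfl fun j hj => ?_
      have hj' := (Finset.mem_filter.1 (Finset.mem_def.2 hj)).1
      rw [hx j (Nat.lt_succ_iff.2 (Finset.mem_Icc.1 hj').2)]
    by_cases h : alg.Completes x d t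
    · have h' : alg.Completes x' d' t := by
        unfold Completes at h ⊢
        rwa [← hb, ← ih']
      rw [state_succ_of_completes _ _ _ h, state_succ_of_completes _ _ _ h', hb, ih']
    · have h' : ¬ alg.Completes x' d' t := by
        unfold Completes at h ⊢
        rwa [← hb, ← ih']
      rw [state_succ_of_not_completes _ _ _ h, state_succ_of_not_completes _ _ _ h', ih']

variable {x d} in
lemma pulledArm_congr {x' : ℕ → Fin A → ℝ} {d' : ℕ → ℕ} {t : ℕ} (hx : ∀ j < t, x j = x' j)
    (hd : ∀ j < t, d j = d' j) : alg.pulledArm x d t = alg.pulledArm x' d' t := by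
  rw [pulledArm, pulledArm, alg.state_congr hx hd]

lemma hist_eq_nil_or (t : ℕ) :
    (alg.state x d t).hist = [] ∨ ∃ e < t, alg.Completes x d e ∧
      (alg.state x d t).hist =
        alg.batchData x d (alg.state x d e) e :: (alg.state x d e).hist := by
  induction t with
  | zero => exact Or.inl rfl
  | succ t ih =>
    by_cases h : alg.Completes x d t
    · exact Or.inr ⟨t, t.lt_succ_self, h, by rw [state_succ_of_completes _ _ _ h]⟩
    · rw [state_succ_of_not_completes _ _ _ h]
      rcases ih with ih | ⟨e, he, h1, h2⟩
      · exact Or.inl ih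
      · exact Or.inr ⟨e, he.trans t.lt_succ_self, h1, h2⟩

end MultiBatchedAlgorithm

/-! ### The clock of BaSE -/

lemma grid_le_pow (K m : ℕ) : grid K m ≤ 2 ^ m := by
  cases m with
  | zero => simp [grid]
  | succ m => exact min_le_left _ _

lemma grid_mono (K : ℕ) : Monotone (grid K) := by
  refine monotone_nat_of_le_succ fun m => ?_
  cases m with
  | zero => simp [grid]
  | succ m => exact min_le_min_right _ (Nat.pow_le_pow_right two_pos (Nat.le_succ _))

lemma numBatches_pos {K : ℕ} (hK : 2 ≤ K) : 0 < numBatches K := Nat.clog_pos one_lt_two hK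

lemma lt_numBatches_of_grid_lt {K m : ℕ} (hK : 2 ≤ K) (h : grid K m < K) : m < numBatches K := by
  by_contra! hm
  obtain ⟨n, rfl⟩ := Nat.exists_eq_succ_of_ne_zero ((numBatches_pos hK).trans_le hm).ne'
  have h1 : K ≤ 2 ^ (n + 1) := (Nat.le_pow_clog one_lt_two K).trans (Nat.pow_le_pow_right two_pos hm)
  simp only [grid] at h
  rw [min_eq_right h1] at h
  exact lt_irrefl _ h

/-- Before the last batch the grid point 2^(m+1) is not truncated by K, while the preceding grid
point is at most 2^m. -/
lemma pow_le_grid_sub {K m : ℕ} (hm : m + 1 < numBatches K) :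
    2 ^ m ≤ grid K (m + 1) - grid K m := by
  have h1 : 2 ^ (m + 1) < K := by
    by_contra! h
    exact absurd ((Nat.clog_le_iff_le_pow one_lt_two).2 h) (not_le.2 hm)
  have h2 := grid_le_pow K m
  have h3 : grid K (m + 1) = 2 ^ (m + 1) := min_eq_left h1.le
  rw [h3, pow_succ]
  omega

section Clock

variable {A : ℕ} [NeZero A] (K : ℕ) (γ : ℝ) (x : ℕ → Fin A → ℝ) (d : ℕ → ℕ)

lemma BaSE_completes_iff (t : ℕ) :
    (BaSE A K γ).Completes x d t ↔
      grid K (((BaSE A K γ).state x d t).hist.length + 1)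
          - grid K ((BaSE A K γ).state x d t).hist.length
        ≤ (arrived d ((BaSE A K γ).state x d t).start t).card := by
  rw [← (BaSE A K γ).card_batchData x d]
  rfl

/-- `isDone` sees only the cardinality of a dataset, which neither arms nor rewards affect. The
clock may thus be evaluated at zero rewards. -/
lemma BaSE_clock (x' : ℕ → Fin A → ℝ) (t : ℕ) :
    ((BaSE A K γ).state x d t).start = ((BaSE A K γ).state x' d t).start ∧
    ((BaSE A K γ).state x d t).hist.length = ((BaSE A K γ).state x' d t).hist.length ∧
    (BaSE A K γ).observed x d t = (BaSE A K γ).observed x' d t := by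
  induction t with
  | zero => exact ⟨rfl, rfl, rfl⟩
  | succ t ih =>
    obtain ⟨h1, h2, h3⟩ := ih
    by_cases h : (BaSE A K γ).Completes x d t
    · have h' : (BaSE A K γ).Completes x' d t := by
        rw [BaSE_completes_iff] at h ⊢
        rwa [← h1, ← h2]
      rw [MultiBatchedAlgorithm.state_succ_of_completes _ _ _ h,
        MultiBatchedAlgorithm.state_succ_of_completes _ _ _ h', MultiBatchedAlgorithm.observed,
        if_pos h, MultiBatchedAlgorithm.observed, if_pos h', h3, h1]
      exact ⟨rfl, by simp [h2], rfl⟩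
    · have h' : ¬ (BaSE A K γ).Completes x' d t := by
        rw [BaSE_completes_iff] at h ⊢
        rwa [← h1, ← h2]
      rw [MultiBatchedAlgorithm.state_succ_of_not_completes _ _ _ h,
        MultiBatchedAlgorithm.state_succ_of_not_completes _ _ _ h', MultiBatchedAlgorithm.observed,
        if_neg h, MultiBatchedAlgorithm.observed, if_neg h']
      exact ⟨h1, h2, h3⟩

/-- Each round contributes at most one observation, so a batch lasts at least as many rounds as the
observations it requires. Consequently the schedule of batches is not exhausted within K rounds. -/
lemma grid_length_le_start (t : ℕ) :
    grid K ((BaSE A K γ).state x d t).hist.length ≤ ((BaSE A K γ).state x d t).start := by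
  induction t with
  | zero => exact le_rfl
  | succ t ih =>
    by_cases h : (BaSE A K γ).Completes x d t
    · rw [MultiBatchedAlgorithm.state_succ_of_completes _ _ _ h]
      rw [BaSE_completes_iff] at h
      have h1 := card_arrived_le d ((BaSE A K γ).state x d t).start t
      have h2 := (BaSE A K γ).start_le x d t
      simp only [List.length_cons]
      omega
    · rwa [MultiBatchedAlgorithm.state_succ_of_not_completes _ _ _ h]

lemma length_lt_numBatches {K : ℕ} (hK : 2 ≤ K) {t : ℕ} (ht : t < K) :
    ((BaSE A K γ).state x d t).hist.length < numBatches K :=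
  lt_numBatches_of_grid_lt hK
    (((grid_length_le_start K γ x d t).trans ((BaSE A K γ).start_le x d t)).trans_lt ht)

/-- A potential `g` that grows in every window by at most the number of arrived observations
plus `β` is at most `2 ^ m` plus `m (β + 1)` in the `m`-th batch. -/
lemma potential_le {g : ℕ → ℝ} {β : ℝ} (hβ : 0 ≤ β) (g0 : g 0 ≤ 0) (g1 : ∀ t, g (t + 1) ≤ g t + 1)
    (hg : ∀ σ e, σ ≤ e → e < K → g (e + 1) - g σ ≤ (arrived d σ e).card + β) {t : ℕ} (ht : t < K) :
    g t ≤ 2 ^ (((BaSE A K γ).state x d t).hist.length + 1)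
      + (((BaSE A K γ).state x d t).hist.length + 1) * (β + 1) := by
  have key : ∀ t < K, g ((BaSE A K γ).state x d t).start
        ≤ grid K ((BaSE A K γ).state x d t).hist.length
          + ((BaSE A K γ).state x d t).hist.length * (β + 1) →
      g t ≤ grid K (((BaSE A K γ).state x d t).hist.length + 1)
        + ((BaSE A K γ).state x d t).hist.length * (β + 1) + β := by
    intro t ht h
    have hm : (grid K ((BaSE A K γ).state x d t).hist.length : ℝ)
        ≤ grid K (((BaSE A K γ).state x d t).hist.length + 1) := by
      exact_mod_cast grid_mono K (Nat.le_succ _)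
    -- Either the batch has just begun, or it was incomplete at the end of the previous round. In
    -- the second case the arrivals were fewer than the grid increment, which telescopes.
    rcases ((BaSE A K γ).start_le x d t).eq_or_lt with h1 | h1
    · rw [h1] at h
      linarith
    · obtain ⟨e, rfl⟩ := Nat.exists_eq_succ_of_ne_zero (Nat.ne_zero_of_lt h1)
      have h2 := Nat.lt_succ_iff.1 h1
      have h3 := (BaSE A K γ).not_completes_of_start_le x d h2
      have h4 := (BaSE A K γ).state_succ_of_not_completes x d h3
      rw [BaSE_completes_iff, not_le, ← h4] at h3
      have h5 := hg _ e h2 (by omega)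
      have h6 : ((arrived d ((BaSE A K γ).state x d (e + 1)).start e).card : ℝ)
          ≤ grid K (((BaSE A K γ).state x d (e + 1)).hist.length + 1)
            - grid K ((BaSE A K γ).state x d (e + 1)).hist.length := by
        rw [le_sub_iff_add_le]
        exact_mod_cast (by omega)
      simp only [Nat.succ_eq_add_one] at h ⊢
      linarith
  have main : ∀ t < K, g ((BaSE A K γ).state x d t).start
        ≤ grid K ((BaSE A K γ).state x d t).hist.length
          + ((BaSE A K γ).state x d t).hist.length * (β + 1) := by
    intro t
    induction t with
    | zero => intro _; simpa [MultiBatchedAlgorithm.state, grid] using g0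
    | succ t ih =>
      intro ht
      have ht' := (Nat.lt_succ_self t).trans ht
      by_cases h : (BaSE A K γ).Completes x d t
      · rw [MultiBatchedAlgorithm.state_succ_of_completes _ _ _ h]
        have h1 := key t ht' (ih ht')
        -- The completing round may add one more unit of potential, whence `β + 1` per batch.
        have h2 := g1 t
        simp only [List.length_cons]
        push_cast
        linarith
      · rw [MultiBatchedAlgorithm.state_succ_of_not_completes _ _ _ h]
        exact ih ht'
  have h1 := key t ht (main t ht)
  have h2 : (grid K (((BaSE A K γ).state x d t).hist.length + 1) : ℝ)
      ≤ 2 ^ (((BaSE A K γ).state x d t).hist.length + 1) := by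
    exact_mod_cast grid_le_pow K _
  linarith

end Clock

/-! ### Elimination of arms -/

section Elimination

variable {A : ℕ}

/-- The smallest number of observations of an arm of `S`. -/
def minCount (S : Finset (Fin A)) (D : Dataset A) : ℕ := ⨅ j : {j // j ∈ S}, count D j.1

lemma minCount_le {S : Finset (Fin A)} (D : Dataset A) {i : Fin A} (hi : i ∈ S) :
    minCount S D ≤ count D i :=
  ciInf_le (OrderBot.bddBelow _) (⟨i, hi⟩ : {j // j ∈ S})

lemma exists_count_eq_minCount {S : Finset (Fin A)} (hS : S.Nonempty) (D : Dataset A) :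
    ∃ i ∈ S, count D i = minCount S D := by
  have : Nonempty {j // j ∈ S} := hS.to_subtype
  obtain ⟨⟨i, hi⟩, h⟩ := exists_eq_ciInf_of_finite (f := fun j : {j // j ∈ S} => count D j.1)
  exact ⟨i, hi, h⟩

lemma mem_activeArms_cons {K : ℕ} {γ : ℝ} {D : Dataset A} {h : History A} {i : Fin A} :
    i ∈ activeArms A K γ (D :: h) ↔ i ∈ activeArms A K γ h ∧
      ¬ (0 < minCount (activeArms A K γ h) (D :: h).sum ∧ ∃ j ∈ activeArms A K γ h,
        Real.sqrt (γ * Real.log ((K : ℝ) * (A : ℝ))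
            / (minCount (activeArms A K γ h) (D :: h).sum : ℝ))
          ≤ average (D :: h).sum j - average (D :: h).sum i) :=
  Finset.mem_filter

variable [NeZero A] {K : ℕ} {γ : ℝ}

lemma arm_mem_activeArms {h : History A} (hS : (activeArms A K γ h).Nonempty) (j : ℕ) :
    (BaSE A K γ).arm h j ∈ activeArms A K γ h := by
  have hl : 0 < ((activeArms A K γ h).sort (· ≤ ·)).length := by
    rw [Finset.length_sort]; exact hS.card_pos
  simp only [BaSE]
  rw [← Finset.mem_sort (· ≤ ·)]
  split_ifs with hm
  · rw [List.getD_eq_getElem _ _ (Nat.mod_lt _ hl)]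
    exact List.getElem_mem _
  · rcases hc : ((activeArms A K γ h).sort (· ≤ ·)).argmax (average h.sum) with _ | i
    · rw [List.argmax_eq_none] at hc
      simp [hc] at hl
    · exact List.argmax_mem hc

/-- Cyclic play gives the arm at position r of the sorted active list exactly the rounds congruent
to r relative to the start of the batch. This is the link between observation counts and
`ArrivalsBalanced`. -/
lemma exists_count_batchData_eq {s : RunState A} (hs : s.hist.length + 1 < numBatches K)
    {i : Fin A} (hi : i ∈ activeArms A K γ s.hist) (x : ℕ → Fin A → ℝ) (d : ℕ → ℕ) (t : ℕ) :
    ∃ r < (activeArms A K γ s.hist).card, count ((BaSE A K γ).batchData x d s t) i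
      = ((arrived d s.start t).filter
          (fun j => (j - s.start) % (activeArms A K γ s.hist).card = r)).card := by
  set l := (activeArms A K γ s.hist).sort (· ≤ ·) with hl
  have hlen : l.length = (activeArms A K γ s.hist).card := Finset.length_sort _
  have hil : i ∈ l := (Finset.mem_sort _).2 hi
  obtain ⟨r, hr, hri⟩ := List.getElem_of_mem hil
  refine ⟨r, hlen ▸ hr, ?_⟩
  have h1 : count ((BaSE A K γ).batchData x d s t) i
      = ((arrived d s.start t).filter (fun j => (BaSE A K γ).armAt s j = i)).card :=
    count_map (arrived d s.start t) (fun j => (BaSE A K γ).armAt s j)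
      (fun j => x j ((BaSE A K γ).armAt s j)) i
  rw [h1]
  congr 1
  refine Finset.filter_congr fun j _ => ?_
  have h2 : (BaSE A K γ).armAt s j = l.getD ((j - s.start) % l.length) 0 := by
    simp only [MultiBatchedAlgorithm.armAt, BaSE, if_pos hs, hl]
  have hlt : (j - s.start) % l.length < l.length := Nat.mod_lt _ (Nat.zero_lt_of_lt hr)
  rw [h2, List.getD_eq_getElem _ _ hlt, ← hri, ← hlen]
  exact (Finset.sort_nodup (activeArms A K γ s.hist) (· ≤ ·)).getElem_inj_iff

/-- At the beginning of every batch within the horizon the observed averages of all arms are close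
to their means. -/
def RewardsConcentrated (A K : ℕ) [NeZero A] (γ : ℝ) (ν : Fin A → Measure ℝ)
    (x : ℕ → Fin A → ℝ) (d : ℕ → ℕ) : Prop :=
  ∀ t < K, ∀ i, 0 < count ((BaSE A K γ).state x d t).hist.sum i →
    |average ((BaSE A K γ).state x d t).hist.sum i - meanReward ν i|
      < Real.sqrt (γ * Real.log ((K : ℝ) * (A : ℝ))
          / (count ((BaSE A K γ).state x d t).hist.sum i : ℝ)) / 2

/-- In every window and for every residue class, the class receives a fair share of the
observations that arrive within the window. -/
def ArrivalsBalanced (K : ℕ) (κ : ℝ) (d : ℕ → ℕ) : Prop :=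
  ∀ σ < K, ∀ e < K, ∀ s ≤ K, ∀ r < s, ((arrived d σ e).card : ℝ)
    ≤ s * (4 * ((arrived d σ e).filter (fun j => (j - σ) % s = r)).card + κ)

variable {ν : Fin A → Measure ℝ} {x : ℕ → Fin A → ℝ} {d : ℕ → ℕ}

lemma log_mul_nonneg (A K : ℕ) : 0 ≤ Real.log ((K : ℝ) * (A : ℝ)) := by
  exact_mod_cast Real.log_natCast_nonneg (K * A)

/-- Every arm of S has at least the minimal number of observations, so its own radius is at most
half the common elimination threshold. -/
lemma RewardsConcentrated.abs_sub_lt (hγ : 0 ≤ γ) (H : RewardsConcentrated A K γ ν x d) {t : ℕ}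
    (ht : t < K) {S : Finset (Fin A)}
    (hn : 0 < minCount S ((BaSE A K γ).state x d t).hist.sum) {i : Fin A} (hi : i ∈ S) :
    |average ((BaSE A K γ).state x d t).hist.sum i - meanReward ν i|
      < Real.sqrt (γ * Real.log ((K : ℝ) * (A : ℝ))
          / (minCount S ((BaSE A K γ).state x d t).hist.sum : ℝ)) / 2 := by
  have h1 := minCount_le ((BaSE A K γ).state x d t).hist.sum hi
  refine (H t ht i (hn.trans_le h1)).trans_le ?_
  have := log_mul_nonneg A K
  gcongr

/-- Both averages in a comparison err by less than half the threshold, so no arm can appear better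
than b by the full threshold. -/
lemma RewardsConcentrated.best_mem_activeArms (hγ : 0 ≤ γ) (H : RewardsConcentrated A K γ ν x d)
    {b : Fin A} (hb : ∀ j, meanReward ν j ≤ meanReward ν b) {t : ℕ} (ht : t < K) :
    b ∈ activeArms A K γ ((BaSE A K γ).state x d t).hist := by
  induction t with
  | zero => exact Finset.mem_univ _
  | succ t ih =>
    have ih' := ih (t.lt_succ_self.trans ht)
    by_cases h : (BaSE A K γ).Completes x d t
    · have key := fun S hn i hi => H.abs_sub_lt hγ ht (S := S) hn (i := i) hi
      rw [MultiBatchedAlgorithm.state_succ_of_completes _ _ _ h] at key ⊢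
      rw [mem_activeArms_cons]
      refine ⟨ih', ?_⟩
      rintro ⟨hn, j, hj, hle⟩
      have h1 := abs_lt.1 (key _ hn j hj)
      have h2 := abs_lt.1 (key _ hn b ih')
      have h3 := hb j
      linarith [h1.1, h1.2, h2.1, h2.2]
    · rwa [MultiBatchedAlgorithm.state_succ_of_not_completes _ _ _ h]

/-- The length of a batch in which a suboptimal arm is active. -/
lemma pow_le_of_mem_activeArms (hγ : 0 ≤ γ) (hK : 2 ≤ K) (hAK : A ≤ K) {κ : ℝ} (hκ : 1 ≤ κ)
    (H : RewardsConcentrated A K γ ν x d) (H' : ArrivalsBalanced K κ d)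
    {b : Fin A} (hb : ∀ j, meanReward ν j ≤ meanReward ν b) {t : ℕ} (ht : t < K) {i : Fin A}
    (hi : i ∈ activeArms A K γ ((BaSE A K γ).state x d t).hist) {δ : ℝ}
    (hδ : δ = meanReward ν b - meanReward ν i) (hδ0 : 0 < δ) (hδ1 : δ ≤ 1) :
    (2 : ℝ) ^ (((BaSE A K γ).state x d t).hist.length + 1)
      ≤ 4 * A * (16 * γ * Real.log ((K : ℝ) * (A : ℝ)) + κ) / δ ^ 2 := by
  have hL := log_mul_nonneg A K
  have hA1 : (1 : ℝ) ≤ A := by exact_mod_cast NeZero.one_le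
  have hδ2 : δ ^ 2 ≤ 1 := pow_le_one₀ hδ0.le hδ1
  have hδ3 : 0 < δ ^ 2 := by positivity
  rw [le_div_iff₀ hδ3]
  -- In the first batch no test has taken place; there κ ≥ 1 and δ ≤ 1 suffice.
  rcases (BaSE A K γ).hist_eq_nil_or x d t with hnil | ⟨e, he, hc, hh⟩
  · rw [hnil]
    have h1 : (1 : ℝ) * 1 ≤ A * (16 * γ * Real.log ((K : ℝ) * (A : ℝ)) + κ) := by
      apply mul_le_mul hA1 _ zero_le_one (by linarith)
      have : 0 ≤ 16 * γ * Real.log ((K : ℝ) * (A : ℝ)) := by positivity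
      linarith
    have h2 : (2 : ℝ) ^ (([] : History A).length + 1) = 2 := by simp
    rw [h2]
    linarith
  · have hM := length_lt_numBatches γ x d hK ht
    have key := fun hn i hi => H.abs_sub_lt hγ ht
      (S := activeArms A K γ ((BaSE A K γ).state x d e).hist) hn (i := i) hi
    rw [hh] at hM hi key ⊢
    simp only [List.length_cons] at hM ⊢
    have heK := he.trans ht
    have hbS := H.best_mem_activeArms hγ hb heK
    rw [mem_activeArms_cons] at hi
    obtain ⟨hiS, hi⟩ := hi
    set S := activeArms A K γ ((BaSE A K γ).state x d e).hist with hS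
    set D := (BaSE A K γ).batchData x d ((BaSE A K γ).state x d e) e with hD
    set n := minCount S (D :: ((BaSE A K γ).state x d e).hist).sum with hn
    -- the number of observations is small
    have h1 : (n : ℝ) * δ ^ 2 ≤ 4 * (γ * Real.log ((K : ℝ) * (A : ℝ))) := by
      rcases Nat.eq_zero_or_pos n with h0 | h0
      · rw [h0]; simp; positivity
      · have h2 := abs_lt.1 (key h0 i hiS)
        have h3 := abs_lt.1 (key h0 b hbS)
        have h4 : average (D :: ((BaSE A K γ).state x d e).hist).sum b
            - average (D :: ((BaSE A K γ).state x d e).hist).sum i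
            < Real.sqrt (γ * Real.log ((K : ℝ) * (A : ℝ)) / (n : ℝ)) := by
          by_contra! h4
          exact hi ⟨h0, b, hbS, h4⟩
        have h5 : δ < 2 * Real.sqrt (γ * Real.log ((K : ℝ) * (A : ℝ)) / (n : ℝ)) := by
          linarith [h2.1, h2.2, h3.1, h3.2]
        have h6 : δ ^ 2 ≤ (2 * Real.sqrt (γ * Real.log ((K : ℝ) * (A : ℝ)) / (n : ℝ))) ^ 2 := by
          gcongr
        have hn0 : (0 : ℝ) < n := by exact_mod_cast h0
        rw [mul_pow, Real.sq_sqrt (by positivity)] at h6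
        calc (n : ℝ) * δ ^ 2 ≤ n * (2 ^ 2 * (γ * Real.log ((K : ℝ) * (A : ℝ)) / (n : ℝ))) := by
              gcongr
          _ = _ := by field_simp; ring
    obtain ⟨k, hkS, hk⟩ := exists_count_eq_minCount ⟨b, hbS⟩
      (D :: ((BaSE A K γ).state x d e).hist).sum
    obtain ⟨r, hr, hcount⟩ := exists_count_batchData_eq (K := K) (γ := γ) hM hkS x d e
    -- The last completed batch alone already observes the rarest arm k at most n times, so its fair
    -- share of the arrivals bounds the size of that batch.
    have h7 : count D k ≤ n := by
      rw [hn, ← hk, List.sum_cons, count_add]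
      exact Nat.le_add_right _ _
    have hσ := ((BaSE A K γ).start_le x d e).trans_lt heK
    have hSA : S.card ≤ A := by simpa using Finset.card_le_univ S
    have h8 := H' _ hσ e heK S.card (hSA.trans hAK) r hr
    rw [← hcount, ← hD] at h8
    -- The completed batch was not the last one, so it has at least 2^ℓ observations, where ℓ is the
    -- number of batches before it. The target exponent is ℓ + 2, hence the factor 4 below.
    have h9 : ((2 : ℕ) ^ ((BaSE A K γ).state x d e).hist.length : ℝ)
        ≤ ((arrived d ((BaSE A K γ).state x d e).start e).card : ℝ) := by
      exact_mod_cast (pow_le_grid_sub hM).trans ((BaSE_completes_iff K γ x d e).1 hc)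
    push_cast at h9
    have h10 : (S.card : ℝ) * (4 * (count D k : ℝ) + κ) ≤ A * (4 * n + κ) := by
      gcongr
    calc (2 : ℝ) ^ (((BaSE A K γ).state x d e).hist.length + 1 + 1) * δ ^ 2
        = 4 * 2 ^ ((BaSE A K γ).state x d e).hist.length * δ ^ 2 := by ring
      _ ≤ 4 * (A * (4 * n + κ)) * δ ^ 2 := by
          gcongr
          exact h9.trans (h8.trans h10)
      _ = 4 * A * (4 * (n * δ ^ 2) + κ * δ ^ 2) := by ring
      _ ≤ 4 * A * (4 * (4 * (γ * Real.log ((K : ℝ) * (A : ℝ)))) + κ * 1) := by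
          gcongr
      _ = _ := by ring

end Elimination

/-! ### Summation of the regret -/

/-- Telescoping: 1/√(n+1) ≤ 2(√(n+1) − √n). -/
lemma sum_inv_sqrt_le (n : ℕ) :
    ∑ j ∈ Finset.range n, 1 / Real.sqrt ((j : ℝ) + 1) ≤ 2 * Real.sqrt n := by
  induction n with
  | zero => simp
  | succ n ih =>
    rw [Finset.sum_range_succ]
    have h0 : 0 < Real.sqrt ((n : ℝ) + 1) := by positivity
    have h1 : Real.sqrt ((n : ℝ) + 1) ^ 2 = n + 1 := Real.sq_sqrt (by positivity)
    have h2 : Real.sqrt (n : ℝ) ^ 2 = n := Real.sq_sqrt (by positivity)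
    have h3 : 1 / Real.sqrt ((n : ℝ) + 1) ≤ 2 * (Real.sqrt ((n : ℝ) + 1) - Real.sqrt n) := by
      rw [div_le_iff₀ h0]
      nlinarith [sq_nonneg (Real.sqrt ((n : ℝ) + 1) - Real.sqrt n)]
    push_cast
    linarith

/-- If a positive value `v` of `g` (with `δ ≤ v ≤ 1`) can only occur up to time `H / v ^ 2 + b`,
then the sum of `g` is at most of order `b + H / δ`. -/
lemma sum_le_of_eq_zero_or {g : ℕ → ℝ} {H b δ : ℝ} (hH : 0 ≤ H) (hb : 0 ≤ b) (hδ : 0 < δ)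
    (hg : ∀ t, g t = 0 ∨ (δ ≤ g t ∧ g t ≤ 1 ∧ (t : ℝ) ≤ H / g t ^ 2 + b)) (n : ℕ) :
    ∑ t ∈ Finset.range n, g t ≤ b + 2 + 2 * (H / δ) := by
  set N := ⌈b⌉₊ with hN
  set Q := ⌊H / δ ^ 2⌋₊ with hQ
  have hg0 : ∀ t, 0 ≤ g t := fun t => by
    rcases hg t with h | h
    · exact h.ge
    · exact hδ.le.trans h.1
  have hg1 : ∀ t, g t ≤ 1 := fun t => by
    rcases hg t with h | h
    · exact h.le.trans zero_le_one
    · exact h.2.1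
  have hbN : b ≤ N := Nat.le_ceil b
  have hNb : (N : ℝ) ≤ b + 1 := (Nat.ceil_lt_add_one hb).le
  -- A positive value is at least δ and so cannot occur after H/δ² + b.
  have hz : ∀ t, N + 1 + Q ≤ t → g t = 0 := fun t ht => by
    rcases hg t with h | ⟨h1, h2, h3⟩
    · exact h
    exfalso
    have h4 : H / g t ^ 2 ≤ H / δ ^ 2 := by gcongr
    have h5 : H / δ ^ 2 < Q + 1 := Nat.lt_floor_add_one _
    have h6 : (N : ℝ) + 1 + Q ≤ t := by exact_mod_cast ht
    linarith
  -- The shift by N + 1 leaves t − b ≥ j + 1, so a positive value v satisfies v² ≤ H/(j + 1).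
  have hs : ∀ j : ℕ, g (N + 1 + j) ≤ Real.sqrt H * (1 / Real.sqrt ((j : ℝ) + 1)) := fun j => by
    rcases hg (N + 1 + j) with h | ⟨h1, h2, h3⟩
    · rw [h]; positivity
    have h0 := hδ.trans_le h1
    have h4 : (j : ℝ) + 1 ≤ H / g (N + 1 + j) ^ 2 := by
      push_cast at h3
      linarith
    rw [mul_one_div, ← Real.sqrt_div hH]
    apply Real.le_sqrt_of_sq_le
    rw [le_div_iff₀ (by positivity)] at h4 ⊢
    linarith
  calc ∑ t ∈ Finset.range n, g t
      ≤ ∑ t ∈ Finset.range (max n (N + 1 + Q)), g t :=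
        Finset.sum_le_sum_of_subset_of_nonneg (Finset.range_subset_range.2 (le_max_left _ _))
          fun t _ _ => hg0 t
    _ = ∑ t ∈ Finset.range (N + 1 + Q), g t := by
        refine (Finset.sum_subset (Finset.range_subset_range.2 (le_max_right _ _)) ?_).symm
        intro t _ ht
        exact hz t (by simpa using ht)
    _ = ∑ t ∈ Finset.range (N + 1), g t + ∑ j ∈ Finset.range Q, g (N + 1 + j) :=
        Finset.sum_range_add _ _ _
    _ ≤ ∑ t ∈ Finset.range (N + 1), 1
        + ∑ j ∈ Finset.range Q, Real.sqrt H * (1 / Real.sqrt ((j : ℝ) + 1)) :=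
        add_le_add (Finset.sum_le_sum fun t _ => hg1 t) (Finset.sum_le_sum fun j _ => hs j)
    _ ≤ (b + 2) + Real.sqrt H * (2 * Real.sqrt (H / δ ^ 2)) := by
        rw [← Finset.mul_sum]
        refine add_le_add ?_ ?_
        · simp
          linarith
        · refine mul_le_mul_of_nonneg_left ((sum_inv_sqrt_le Q).trans ?_) (Real.sqrt_nonneg _)
          have : (Q : ℝ) ≤ H / δ ^ 2 := Nat.floor_le (by positivity)
          gcongr
    _ = b + 2 + 2 * (H / δ) := by
        rw [Real.sqrt_div hH, Real.sqrt_sq hδ.le]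
        have := Real.mul_self_sqrt hH
        field_simp
        linear_combination 2 * this

/-! ### Optimality gaps, and the regret on the good event -/

section Gap

variable {A : ℕ} {ν : Fin A → Measure ℝ}

lemma minGap_nonneg (ν : Fin A → Measure ℝ) : 0 ≤ minGap ν :=
  Real.sInf_nonneg fun _ h => h.1.le

lemma minGap_le {i : Fin A} (hi : 0 < gap ν i) : minGap ν ≤ gap ν i :=
  csInf_le ⟨0, fun _ h => h.1.le⟩ ⟨hi, i, rfl⟩

lemma minGap_pos {i : Fin A} (hi : 0 < gap ν i) : 0 < minGap ν := by
  have hfin : {δ : ℝ | 0 < δ ∧ ∃ i, gap ν i = δ}.Finite :=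
    (Set.finite_range (gap ν)).subset fun _ h => h.2
  have hne : {δ : ℝ | 0 < δ ∧ ∃ i, gap ν i = δ}.Nonempty := ⟨_, hi, i, rfl⟩
  exact (hne.csInf_mem hfin).1

variable [NeZero A]

lemma exists_best_arm (ν : Fin A → Measure ℝ) :
    ∃ b, (∀ j, meanReward ν j ≤ meanReward ν b) ∧
      ∀ i, gap ν i = meanReward ν b - meanReward ν i := by
  obtain ⟨b, hb⟩ := exists_eq_ciSup_of_finite (f := meanReward ν)
  refine ⟨b, fun j => ?_, fun i => by rw [gap, hb]⟩
  rw [hb]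
  exact le_ciSup (Set.finite_range _).bddAbove j

lemma gap_nonneg (ν : Fin A → Measure ℝ) (i : Fin A) : 0 ≤ gap ν i := by
  obtain ⟨b, hb, hg⟩ := exists_best_arm ν
  rw [hg]
  linarith [hb i]

lemma gap_le_one (hν : ∀ i, 0 ≤ meanReward ν i ∧ meanReward ν i ≤ 1) (i : Fin A) :
    gap ν i ≤ 1 := by
  obtain ⟨b, hb, hg⟩ := exists_best_arm ν
  rw [hg]
  linarith [(hν i).1, (hν b).2]

/-- The regret on the event that rewards are concentrated and arrivals are balanced, given an upper
bound on the time at which the batches end. -/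
lemma sum_gap_le {K : ℕ} {γ : ℝ} {x : ℕ → Fin A → ℝ} {d : ℕ → ℕ} (hγ : 0 ≤ γ) (hK : 2 ≤ K)
    (hAK : A ≤ K) {κ : ℝ} (hκ : 1 ≤ κ) (H : RewardsConcentrated A K γ ν x d)
    (H' : ArrivalsBalanced K κ d) (hν : ∀ i, 0 ≤ meanReward ν i ∧ meanReward ν i ≤ 1)
    (hpos : 0 < minGap ν) {a c : ℝ} (ha : 0 ≤ a) (hc : 0 ≤ c)
    (ht : ∀ t < K, (t : ℝ) ≤ a * 2 ^ (((BaSE A K γ).state x d t).hist.length + 1) + c) :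
    ∑ t ∈ Finset.range K, gap ν ((BaSE A K γ).pulledArm x d t)
      ≤ c + 2 + 2 * (a * (4 * A * (16 * γ * Real.log ((K : ℝ) * (A : ℝ)) + κ)) / minGap ν) := by
  obtain ⟨b, hb, hgap⟩ := exists_best_arm ν
  have hL := log_mul_nonneg A K
  -- The time bound is known only for t < K, so the gaps are extended by 0 before the summation
  -- lemma is applied.
  have h1 : ∑ t ∈ Finset.range K, gap ν ((BaSE A K γ).pulledArm x d t)
      = ∑ t ∈ Finset.range K, if t < K then gap ν ((BaSE A K γ).pulledArm x d t) else 0 :=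
    Finset.sum_congr rfl fun t ht => (if_pos (Finset.mem_range.1 ht)).symm
  rw [h1]
  refine sum_le_of_eq_zero_or (by positivity) hc hpos (fun t => ?_) K
  split_ifs with htK
  swap
  · exact Or.inl rfl
  set i := (BaSE A K γ).pulledArm x d t with hi
  rcases (gap_nonneg ν i).eq_or_lt with h0 | h0
  · exact Or.inl h0.symm
  refine Or.inr ⟨minGap_le h0, gap_le_one hν i, (ht t htK).trans ?_⟩
  have hmem : i ∈ activeArms A K γ ((BaSE A K γ).state x d t).hist :=
    arm_mem_activeArms ⟨b, H.best_mem_activeArms hγ hb htK⟩ _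
  have h2 := pow_le_of_mem_activeArms hγ hK hAK hκ H H' hb htK hmem (hgap i) h0 (gap_le_one hν i)
  rw [mul_div_assoc]
  gcongr

end Gap

/-! ### Measurability for fixed delays -/

section Measurability

variable {E : Type*} [MeasurableSpace E] {A : ℕ}

/-- A random dataset with measurable counts and reward sums. -/
structure MeasurableDataset (f : E → Dataset A) : Prop where
  count : ∀ i, Measurable (fun e => count (f e) i)
  rewardSum : ∀ i, Measurable (fun e => rewardSum (f e) i)

/-- A random history of deterministic length with measurable datasets. -/
inductive MeasurableHistory : (E → History A) → Prop
  | nil : MeasurableHistory (fun _ => [])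
  | cons {D : E → Dataset A} {h : E → History A} :
      MeasurableDataset D → MeasurableHistory h → MeasurableHistory (fun e => D e :: h e)

lemma MeasurableDataset.average {f : E → Dataset A} (hf : MeasurableDataset f) (i : Fin A) :
    Measurable (fun e => average (f e) i) := by
  simp only [average_eq]
  exact (hf.rewardSum i).div (measurable_from_top.comp (hf.count i))

lemma MeasurableDataset.minCount {f : E → Dataset A} (hf : MeasurableDataset f)
    (S : Finset (Fin A)) : Measurable (fun e => minCount S (f e)) := by
  have hF : Measurable (fun c : Fin A → ℕ => ⨅ j : {j // j ∈ S}, c j.1) := measurable_of_countable _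
  exact hF.comp (measurable_pi_iff.2 hf.count)

lemma MeasurableHistory.sum {h : E → History A} (hh : MeasurableHistory h) :
    MeasurableDataset (fun e => (h e).sum) := by
  induction hh with
  | nil =>
    constructor <;> intro i
    · exact measurable_const
    · exact measurable_const
  | cons hD _ ih =>
    constructor <;> intro i
    · simp only [List.sum_cons, count_add]
      exact (hD.count i).add (ih.count i)
    · simp only [List.sum_cons, rewardSum_add]
      exact (hD.rewardSum i).add (ih.rewardSum i)

lemma MeasurableHistory.exists_length_eq {h : E → History A} (hh : MeasurableHistory h) :
    ∃ n, ∀ e, (h e).length = n := by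
  induction hh with
  | nil => exact ⟨0, fun _ => rfl⟩
  | cons _ _ ih =>
    obtain ⟨n, hn⟩ := ih
    exact ⟨n + 1, fun e => by simp [hn e]⟩

/-- Split over the finitely many previous active sets. For a fixed one the elimination test is a
finite combination of inequalities between measurable functions. -/
lemma MeasurableHistory.measurableSet_activeArms {h : E → History A} (hh : MeasurableHistory h)
    (K : ℕ) (γ : ℝ) (S : Finset (Fin A)) : MeasurableSet {e | activeArms A K γ (h e) = S} := by
  induction hh generalizing S with
  | nil => exact MeasurableSet.const _
  | @cons D h hD hh ih =>
    have hs := (MeasurableHistory.cons hD hh).sum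
    have key : ∀ S₀ : Finset (Fin A), ∀ i, MeasurableSet {e |
        0 < DelayedBandit.minCount S₀ (D e :: h e).sum ∧ ∃ j ∈ S₀,
        Real.sqrt (γ * Real.log ((K : ℝ) * (A : ℝ))
            / (DelayedBandit.minCount S₀ (D e :: h e).sum : ℝ))
          ≤ DelayedBandit.average (D e :: h e).sum j
            - DelayedBandit.average (D e :: h e).sum i} := by
      intro S₀ i
      have hm : Measurable fun e => (DelayedBandit.minCount S₀ (D e :: h e).sum : ℝ) :=
        measurable_from_top.comp (hs.minCount S₀)
      refine (measurableSet_lt measurable_const (hs.minCount S₀)).inter ?_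
      have : {e | ∃ j ∈ S₀, Real.sqrt (γ * Real.log ((K : ℝ) * (A : ℝ))
            / (DelayedBandit.minCount S₀ (D e :: h e).sum : ℝ))
          ≤ DelayedBandit.average (D e :: h e).sum j
            - DelayedBandit.average (D e :: h e).sum i} = ⋃ j ∈ S₀,
          {e | Real.sqrt (γ * Real.log ((K : ℝ) * (A : ℝ))
            / (DelayedBandit.minCount S₀ (D e :: h e).sum : ℝ))
          ≤ DelayedBandit.average (D e :: h e).sum j
            - DelayedBandit.average (D e :: h e).sum i} := by
        ext e; simp
      change MeasurableSet {e | ∃ j ∈ S₀, Real.sqrt (γ * Real.log ((K : ℝ) * (A : ℝ))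
            / (DelayedBandit.minCount S₀ (D e :: h e).sum : ℝ))
          ≤ DelayedBandit.average (D e :: h e).sum j
            - DelayedBandit.average (D e :: h e).sum i}
      rw [this]
      refine Finset.measurableSet_biUnion _ fun j _ => ?_
      exact measurableSet_le (measurable_const.div hm).sqrt ((hs.average j).sub (hs.average i))
    have h2 : {e | activeArms A K γ (D e :: h e) = S} = ⋃ S₀ : Finset (Fin A),
        {e | activeArms A K γ (h e) = S₀} ∩ ⋂ i : Fin A, {e | i ∈ S ↔ i ∈ S₀ ∧
        ¬ (0 < DelayedBandit.minCount S₀ (D e :: h e).sum ∧ ∃ j ∈ S₀,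
        Real.sqrt (γ * Real.log ((K : ℝ) * (A : ℝ))
            / (DelayedBandit.minCount S₀ (D e :: h e).sum : ℝ))
          ≤ DelayedBandit.average (D e :: h e).sum j
            - DelayedBandit.average (D e :: h e).sum i)} := by
      ext e
      simp only [Set.mem_ofPred_eq, Set.mem_iUnion, Set.mem_inter_iff, Set.mem_iInter,
        Finset.ext_iff (s₂ := S), mem_activeArms_cons, exists_eq_left']
      exact forall_congr' fun i => Iff.comm
    rw [h2]
    refine MeasurableSet.iUnion fun S₀ => (ih S₀).inter (MeasurableSet.iInter fun i => ?_)
    exact (MeasurableSet.const _).iff ((MeasurableSet.const _).inter (key S₀ i).compl)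

/-- `argmax` returns the first maximizer, so its value is determined by finitely many comparisons.
-/
lemma measurableSet_argmax {ι : Type*} [DecidableEq ι] {f : E → ι → ℝ}
    (hf : ∀ i, Measurable fun e => f e i) (l : List ι) (c i : ι) :
    MeasurableSet {e | (l.argmax (f e)).getD c = i} := by
  rcases l.eq_nil_or_concat with rfl | hl
  · simp only [List.argmax_nil]
    exact MeasurableSet.const _
  have hne : l ≠ [] := by
    obtain ⟨l', b, rfl⟩ := hl
    simp
  have : {e | (l.argmax (f e)).getD c = i} = {e | i ∈ l ∧ (∀ a ∈ l, f e a ≤ f e i) ∧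
      ∀ a ∈ l, f e i ≤ f e a → l.idxOf i ≤ l.idxOf a} := by
    ext e
    simp only [Set.mem_ofPred_eq]
    rw [← List.mem_argmax_iff]
    rcases hc : l.argmax (f e) with _ | b
    · exact absurd (List.argmax_eq_none.1 hc) hne
    · simp
  rw [this]
  refine (MeasurableSet.const _).inter (MeasurableSet.inter ?_ ?_)
  · have h1 : {e | ∀ a ∈ l, f e a ≤ f e i} = ⋂ a ∈ l.toFinset, {e | f e a ≤ f e i} := by
      ext e; simp
    change MeasurableSet {e | ∀ a ∈ l, f e a ≤ f e i}
    rw [h1]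
    exact Finset.measurableSet_biInter _ fun a _ => measurableSet_le (hf a) (hf i)
  · have h1 : {e | ∀ a ∈ l, f e i ≤ f e a → l.idxOf i ≤ l.idxOf a}
        = ⋂ a ∈ l.toFinset, {e | f e i ≤ f e a → l.idxOf i ≤ l.idxOf a} := by
      ext e; simp
    change MeasurableSet {e | ∀ a ∈ l, f e i ≤ f e a → l.idxOf i ≤ l.idxOf a}
    rw [h1]
    exact Finset.measurableSet_biInter _ fun a _ =>
      (measurableSet_le (hf i) (hf a)).imp (MeasurableSet.const _)

variable [NeZero A]

lemma MeasurableHistory.measurableSet_arm {h : E → History A} (hh : MeasurableHistory h)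
    (K : ℕ) (γ : ℝ) (j : ℕ) (i : Fin A) : MeasurableSet {e | (BaSE A K γ).arm (h e) j = i} := by
  obtain ⟨n, hn⟩ := hh.exists_length_eq
  have h1 : {e | (BaSE A K γ).arm (h e) j = i} = ⋃ S : Finset (Fin A),
      {e | activeArms A K γ (h e) = S} ∩ {e | (if n + 1 < numBatches K then
        (S.sort (· ≤ ·)).getD (j % (S.sort (· ≤ ·)).length) 0
        else ((S.sort (· ≤ ·)).argmax (DelayedBandit.average (h e).sum)).getD 0) = i} := by
    ext e
    simp only [Set.mem_iUnion, Set.mem_inter_iff, Set.mem_ofPred_eq, exists_eq_left', BaSE, hn e]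
  rw [h1]
  refine MeasurableSet.iUnion fun S => (hh.measurableSet_activeArms K γ S).inter ?_
  split_ifs
  · exact MeasurableSet.const _
  · exact measurableSet_argmax (fun i => hh.sum.average i) _ _ _

/-- For fixed delays the clock is the same for all rewards, so at each round either all histories
are extended or none is. -/
lemma measurableHistory_state (K : ℕ) (γ : ℝ) (d : ℕ → ℕ) (t : ℕ) :
    MeasurableHistory (fun x : ℕ → Fin A → ℝ => ((BaSE A K γ).state x d t).hist) := by
  induction t with
  | zero => exact MeasurableHistory.nil
  | succ t ih =>
    have hc : ∀ x : ℕ → Fin A → ℝ,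
        (BaSE A K γ).Completes x d t ↔ (BaSE A K γ).Completes (fun _ _ => 0) d t := by
      intro x
      rw [BaSE_completes_iff, BaSE_completes_iff, (BaSE_clock K γ x d (fun _ _ => 0) t).1,
        (BaSE_clock K γ x d (fun _ _ => 0) t).2.1]
    by_cases h : (BaSE A K γ).Completes (fun _ _ => 0) d t
    · have h1 : (fun x : ℕ → Fin A → ℝ => ((BaSE A K γ).state x d (t + 1)).hist) = fun x =>
          (BaSE A K γ).batchData x d ((BaSE A K γ).state x d t) t
            :: ((BaSE A K γ).state x d t).hist := by
        ext1 x
        rw [MultiBatchedAlgorithm.state_succ_of_completes _ _ _ ((hc x).2 h)]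
      rw [h1]
      refine MeasurableHistory.cons ?_ ih
      set σ := ((BaSE A K γ).state (fun _ _ => 0) d t).start with hσ
      have hD : ∀ x : ℕ → Fin A → ℝ, (BaSE A K γ).batchData x d ((BaSE A K γ).state x d t) t
          = (arrived d σ t).val.map (fun j =>
            ((BaSE A K γ).arm ((BaSE A K γ).state x d t).hist (j - σ),
              x j ((BaSE A K γ).arm ((BaSE A K γ).state x d t).hist (j - σ)))) := by
        intro x
        rw [hσ, ← (BaSE_clock K γ x d (fun _ _ => 0) t).1]
        rfl
      have hm := fun j i => ih.measurableSet_arm K γ j i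
      constructor <;> intro i
      · simp only [hD]
        have : (fun x : ℕ → Fin A → ℝ => count ((arrived d σ t).val.map (fun j =>
            ((BaSE A K γ).arm ((BaSE A K γ).state x d t).hist (j - σ),
              x j ((BaSE A K γ).arm ((BaSE A K γ).state x d t).hist (j - σ))))) i)
            = fun x => ∑ j ∈ arrived d σ t,
              if (BaSE A K γ).arm ((BaSE A K γ).state x d t).hist (j - σ) = i then 1 else 0 := by
          ext1 x
          rw [count_map, Finset.card_filter]
        rw [this]
        exact Finset.measurable_fun_sum _ fun j _ =>
          Measurable.ite (hm _ i) measurable_const measurable_const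
      · simp only [hD]
        have : (fun x : ℕ → Fin A → ℝ => rewardSum ((arrived d σ t).val.map (fun j =>
            ((BaSE A K γ).arm ((BaSE A K γ).state x d t).hist (j - σ),
              x j ((BaSE A K γ).arm ((BaSE A K γ).state x d t).hist (j - σ))))) i)
            = fun x => ∑ j ∈ arrived d σ t,
              if (BaSE A K γ).arm ((BaSE A K γ).state x d t).hist (j - σ) = i
              then x j i else 0 := by
          ext1 x
          rw [rewardSum_map, Finset.sum_filter]
          refine Finset.sum_congr rfl fun j _ => ?_
          split_ifs with hj
          · rw [hj]
          · rfl
        rw [this]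
        exact Finset.measurable_fun_sum _ fun j _ =>
          Measurable.ite (hm _ i) ((measurable_pi_apply i).comp (measurable_pi_apply j))
            measurable_const
    · have h1 : (fun x : ℕ → Fin A → ℝ => ((BaSE A K γ).state x d (t + 1)).hist) = fun x =>
          ((BaSE A K γ).state x d t).hist := by
        ext1 x
        rw [MultiBatchedAlgorithm.state_succ_of_not_completes _ _ _ (mt (hc x).1 h)]
      rw [h1]
      exact ih

lemma measurable_pulledArm (K : ℕ) (γ : ℝ) (d : ℕ → ℕ) (t : ℕ) :
    Measurable (fun x : ℕ → Fin A → ℝ => (BaSE A K γ).pulledArm x d t) := by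
  refine measurable_to_countable' fun i => ?_
  set σ := ((BaSE A K γ).state (fun _ _ => 0) d t).start with hσ
  have : (fun x : ℕ → Fin A → ℝ => (BaSE A K γ).pulledArm x d t)
      = fun x => (BaSE A K γ).arm ((BaSE A K γ).state x d t).hist (t - σ) := by
    ext1 x
    rw [hσ, ← (BaSE_clock K γ x d (fun _ _ => 0) t).1]
    rfl
  rw [this]
  exact (measurableHistory_state K γ d t).measurableSet_arm K γ _ i

end Measurability

/-! ### Concentration of the arrivals -/

/-- Among the terms of an antitone sequence with values in `[0, 1]`, the sum over a residue class
modulo `s` is at least about the `s`-th part of the sum. -/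
lemma sum_le_mul_sum_filter_mod {G : ℕ → ℝ} {σ e s r : ℕ} (hr : r < s) (h0 : ∀ j, 0 ≤ G j)
    (h1 : ∀ j, G j ≤ 1) (hG : ∀ j j', σ ≤ j → j ≤ j' → j' ≤ e → G j' ≤ G j) :
    ∑ j ∈ Finset.Icc σ e, G j
      ≤ s * (∑ j ∈ (Finset.Icc σ e).filter (fun j => (j - σ) % s = r), G j + 1) := by
  have hs : 0 < s := Nat.zero_lt_of_lt hr
  rw [← Finset.sum_filter_add_sum_filter_not (Finset.Icc σ e) (fun j => σ + r ≤ j)]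
  have hsmall : ∑ j ∈ (Finset.Icc σ e).filter (fun j => ¬ σ + r ≤ j), G j ≤ s := by
    calc ∑ j ∈ (Finset.Icc σ e).filter (fun j => ¬ σ + r ≤ j), G j
        ≤ ∑ j ∈ (Finset.Icc σ e).filter (fun j => ¬ σ + r ≤ j), 1 :=
          Finset.sum_le_sum fun j _ => h1 j
      _ = (((Finset.Icc σ e).filter (fun j => ¬ σ + r ≤ j)).card : ℝ) := by simp
      _ ≤ ((Finset.Ico σ (σ + s)).card : ℝ) := by
          gcongr
          intro j hj
          simp only [Finset.mem_filter, Finset.mem_Icc] at hj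
          simp only [Finset.mem_Ico]
          omega
      _ = s := by simp
  have hlarge : ∑ j ∈ (Finset.Icc σ e).filter (fun j => σ + r ≤ j), G j
      ≤ s * ∑ j ∈ (Finset.Icc σ e).filter (fun j => (j - σ) % s = r), G j := by
    -- `π j` is the last member of the residue class not exceeding j. Its fibres lie in intervals of
    -- length s, at whose left end G is largest.
    set π : ℕ → ℕ := fun j => j - (j - σ - r) % s with hπ
    have hle : ∀ j, (j - σ - r) % s ≤ j - σ - r := fun j => Nat.mod_le _ _
    have hmaps : ∀ j ∈ (Finset.Icc σ e).filter (fun j => σ + r ≤ j),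
        π j ∈ (Finset.Icc σ e).filter (fun j => (j - σ) % s = r) := by
      intro j hj
      simp only [Finset.mem_filter, Finset.mem_Icc] at hj ⊢
      have h2 := hle j
      have h3 : π j - σ = r + s * ((j - σ - r) / s) := by
        have := Nat.div_add_mod (j - σ - r) s
        simp only [hπ]
        omega
      refine ⟨by simp only [hπ]; omega, ?_⟩
      rw [h3, Nat.add_mul_mod_self_left, Nat.mod_eq_of_lt hr]
    rw [← Finset.sum_fiberwise_of_maps_to hmaps, Finset.mul_sum]
    refine Finset.sum_le_sum fun k hk => ?_
    simp only [Finset.mem_filter, Finset.mem_Icc] at hk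
    have hfib : ∀ j ∈ ((Finset.Icc σ e).filter (fun j => σ + r ≤ j)).filter (fun j => π j = k),
        j ∈ Finset.Ico k (k + s) ∧ G j ≤ G k := by
      intro j hj
      simp only [Finset.mem_filter, Finset.mem_Icc, hπ] at hj
      have h2 := Nat.mod_lt (j - σ - r) hs
      have h3 := hle j
      refine ⟨by simp only [Finset.mem_Ico]; omega, hG k j hk.1.1 (by omega) hj.1.1.2⟩
    calc ∑ j ∈ ((Finset.Icc σ e).filter (fun j => σ + r ≤ j)).filter (fun j => π j = k), G j
        ≤ ∑ j ∈ ((Finset.Icc σ e).filter (fun j => σ + r ≤ j)).filter (fun j => π j = k), G k :=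
          Finset.sum_le_sum fun j hj => (hfib j hj).2
      _ ≤ ∑ j ∈ Finset.Ico k (k + s), G k :=
          Finset.sum_le_sum_of_subset_of_nonneg (fun j hj => (hfib j hj).1) fun _ _ _ => h0 k
      _ = s * G k := by simp
  linarith

section Arrivals

variable {Ω : Type*} {T : ℕ → Ω → ℕ}

/-- The number of the rounds of `J` with delays below the thresholds `u`. -/
def numBelow (T : ℕ → Ω → ℕ) (J : Finset ℕ) (u : ℕ → ℕ) (ω : Ω) : ℝ :=
  ∑ j ∈ J, Set.indicator {ω | T j ω ≤ u j} 1 ω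

lemma numBelow_eq_card (J : Finset ℕ) (u : ℕ → ℕ) (ω : Ω) :
    numBelow T J u ω = ((J.filter (fun j => T j ω ≤ u j)).card : ℝ) := by
  simp [numBelow, Set.indicator_apply, Finset.sum_boole]

lemma card_arrived_eq_numBelow (σ e : ℕ) (p : ℕ → Prop) [DecidablePred p] (ω : Ω) :
    (((arrived (fun j => T j ω) σ e).filter p).card : ℝ)
      = numBelow T ((Finset.Icc σ e).filter p) (fun j => e - j) ω := by
  rw [numBelow_eq_card, arrived, Finset.filter_filter, Finset.filter_filter]
  congr 2
  refine Finset.filter_congr fun j hj => ?_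
  have := (Finset.mem_Icc.1 hj).2
  rw [and_comm]
  exact and_congr_right fun _ => by omega

variable [MeasurableSpace Ω] {P : Measure Ω} [IsProbabilityMeasure P] {ρ : Measure ℕ}

lemma measurable_indicator_le (hT : ∀ t, Measurable (T t)) (u : ℕ → ℕ) (j : ℕ) :
    Measurable (Set.indicator {ω | T j ω ≤ u j} (1 : Ω → ℝ)) :=
  measurable_one.indicator (measurableSet_le (hT j) measurable_const)

/-- The Bernoulli value 1 + p(e^l − 1) is at most the Poisson one, by 1 + y ≤ e^y. -/
lemma mgf_indicator_le (hT : ∀ t, Measurable (T t)) (hlaw : ∀ t, P.map (T t) = ρ)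
    (u : ℕ → ℕ) (j : ℕ) (l : ℝ) :
    mgf (Set.indicator {ω | T j ω ≤ u j} (1 : Ω → ℝ)) P l
      ≤ Real.exp (ρ.real (Set.Iic (u j)) * (Real.exp l - 1)) := by
  have hs : MeasurableSet {ω | T j ω ≤ u j} := measurableSet_le (hT j) measurable_const
  have h1 : ∀ ω, Real.exp (l * Set.indicator {ω | T j ω ≤ u j} (1 : Ω → ℝ) ω)
      = 1 + Set.indicator {ω | T j ω ≤ u j} (1 : Ω → ℝ) ω * (Real.exp l - 1) := by
    intro ω
    by_cases h : ω ∈ {ω | T j ω ≤ u j}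
    · rw [Set.indicator_of_mem h]; simp
    · rw [Set.indicator_of_notMem h]; simp
  have h2 : ∫ ω, Set.indicator {ω | T j ω ≤ u j} (1 : Ω → ℝ) ω ∂P = ρ.real (Set.Iic (u j)) := by
    rw [integral_indicator_one hs, ← hlaw j, map_measureReal_apply (hT j) measurableSet_Iic]
    rfl
  have h3 : Integrable (Set.indicator {ω | T j ω ≤ u j} (1 : Ω → ℝ)) P :=
    (integrable_const (1 : ℝ)).indicator hs
  rw [mgf]
  simp_rw [h1]
  rw [integral_add (integrable_const _) (h3.mul_const _), integral_mul_const, h2]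
  simp only [integral_const, probReal_univ, smul_eq_mul, mul_one]
  rw [add_comm]
  exact Real.add_one_le_exp _

lemma mgf_numBelow_le (hT : ∀ t, Measurable (T t)) (hlaw : ∀ t, P.map (T t) = ρ)
    (hind : iIndepFun T P) (J : Finset ℕ) (u : ℕ → ℕ) (l : ℝ) :
    mgf (numBelow T J u) P l
      ≤ Real.exp ((∑ j ∈ J, ρ.real (Set.Iic (u j))) * (Real.exp l - 1)) := by
  have h1 : iIndepFun (fun j => Set.indicator {ω | T j ω ≤ u j} (1 : Ω → ℝ)) P := by
    have h := hind.comp (fun j n => if n ≤ u j then (1 : ℝ) else 0)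
      fun j => measurable_of_countable _
    convert h using 2 with j
    ext ω
    simp [Set.indicator_apply]
  have h2 : numBelow T J u = ∑ j ∈ J, Set.indicator {ω | T j ω ≤ u j} (1 : Ω → ℝ) := by
    ext ω
    simp [numBelow]
  rw [h2, h1.mgf_sum (measurable_indicator_le hT u), Finset.sum_mul, Real.exp_sum]
  exact Finset.prod_le_prod (fun _ _ => mgf_nonneg) fun j _ => mgf_indicator_le hT hlaw u j l

lemma integrable_exp_numBelow (hT : ∀ t, Measurable (T t)) (J : Finset ℕ) (u : ℕ → ℕ) (l : ℝ) :
    Integrable (fun ω => Real.exp (l * numBelow T J u ω)) P := by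
  have hm : Measurable (numBelow T J u) :=
    Finset.measurable_fun_sum _ fun j _ => measurable_indicator_le hT u j
  refine Integrable.of_bound (C := Real.exp (|l| * J.card))
    (Real.measurable_exp.comp (hm.const_mul l)).aestronglyMeasurable (.of_forall fun ω => ?_)
  rw [Real.norm_eq_abs, Real.abs_exp, Real.exp_le_exp]
  have h0 : 0 ≤ numBelow T J u ω := by rw [numBelow_eq_card]; positivity
  have h1 : numBelow T J u ω ≤ J.card := by
    rw [numBelow_eq_card]
    exact_mod_cast Finset.card_filter_le _ _
  exact mul_le_mul (le_abs_self l) h1 h0 (abs_nonneg l)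

/-- Chernoff with exponent 1: twice the mean absorbs the factor e − 1 ≤ 2. -/
lemma measureReal_ge_numBelow_le (hT : ∀ t, Measurable (T t)) (hlaw : ∀ t, P.map (T t) = ρ)
    (hind : iIndepFun T P) (J : Finset ℕ) (u : ℕ → ℕ) (l : ℝ) :
    P.real {ω | 2 * ∑ j ∈ J, ρ.real (Set.Iic (u j)) + l ≤ numBelow T J u ω} ≤ Real.exp (-l) := by
  have h0 : 0 ≤ ∑ j ∈ J, ρ.real (Set.Iic (u j)) := Finset.sum_nonneg fun _ _ => measureReal_nonneg
  have h1 := Real.exp_one_lt_d9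
  refine (measure_ge_le_exp_mul_mgf _ zero_le_one (integrable_exp_numBelow hT J u 1)).trans ?_
  refine (mul_le_mul_of_nonneg_left (mgf_numBelow_le hT hlaw hind J u 1)
    (Real.exp_nonneg _)).trans ?_
  rw [← Real.exp_add, Real.exp_le_exp]
  nlinarith

/-- Chernoff with exponent −1, using 1 − 1/e ≥ 1/2. -/
lemma measureReal_le_numBelow_le (hT : ∀ t, Measurable (T t)) (hlaw : ∀ t, P.map (T t) = ρ)
    (hind : iIndepFun T P) (J : Finset ℕ) (u : ℕ → ℕ) (l : ℝ) :
    P.real {ω | numBelow T J u ω ≤ (∑ j ∈ J, ρ.real (Set.Iic (u j))) / 2 - l} ≤ Real.exp (-l) := by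
  have h0 : 0 ≤ ∑ j ∈ J, ρ.real (Set.Iic (u j)) := Finset.sum_nonneg fun _ _ => measureReal_nonneg
  have h1 : Real.exp (-1) ≤ 1 / 2 := by
    rw [Real.exp_neg, one_div]
    exact inv_anti₀ two_pos (by linarith [Real.add_one_le_exp 1])
  refine (measure_le_le_exp_mul_mgf _ (by norm_num : (-1 : ℝ) ≤ 0)
    (integrable_exp_numBelow hT J u (-1))).trans ?_
  refine (mul_le_mul_of_nonneg_left (mgf_numBelow_le hT hlaw hind J u (-1))
    (Real.exp_nonneg _)).trans ?_
  rw [← Real.exp_add, Real.exp_le_exp]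
  nlinarith

/-- The arrival probability of round j by time e decreases in j, so the expected number m of
arrivals is at most s(m_r + 1), where m_r is the share of the class. Off the Chernoff events N < 2m
+ l and m_r < 2(N_r + l), so N ≤ s(4N_r + 4l + 2) + l, which explains 5l + 2. The union runs over
windows, moduli and residues. -/
lemma measureReal_not_arrivalsBalanced_le (hT : ∀ t, Measurable (T t))
    (hlaw : ∀ t, P.map (T t) = ρ) (hind : iIndepFun T P) (K : ℕ) (l : ℝ) :
    P.real {ω | ¬ ArrivalsBalanced K (5 * l + 2) (fun j => T j ω)}
      ≤ 2 * (K : ℝ) ^ 4 * Real.exp (-l) := by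
  have : IsProbabilityMeasure ρ := hlaw 0 ▸ Measure.isProbabilityMeasure_map (hT 0).aemeasurable
  -- For negative l the claimed bound exceeds 1, unless K = 0, where the bad event is empty.
  rcases lt_or_ge l 0 with hl | hl
  · rcases Nat.eq_zero_or_pos K with rfl | hK
    · simp [ArrivalsBalanced]
    · have h1 : (1 : ℝ) ≤ (K : ℝ) ^ 4 := one_le_pow₀ (by exact_mod_cast hK)
      have h2 : 1 ≤ Real.exp (-l) := Real.one_le_exp (by linarith)
      refine measureReal_le_one.trans ?_
      nlinarith
  set J : ℕ × ℕ × ℕ × ℕ → Finset ℕ := fun k =>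
    (Finset.Icc k.1 k.2.1).filter (fun j => (j - k.1) % k.2.2.1 = k.2.2.2) with hJ
  set m : ℕ → Finset ℕ → ℝ := fun e J => ∑ j ∈ J, ρ.real (Set.Iic (e - j)) with hm
  set bad : ℕ × ℕ × ℕ × ℕ → Set Ω := fun k =>
    {ω | 2 * m k.2.1 (Finset.Icc k.1 k.2.1) + l
        ≤ numBelow T (Finset.Icc k.1 k.2.1) (fun j => k.2.1 - j) ω}
    ∪ {ω | numBelow T (J k) (fun j => k.2.1 - j) ω ≤ m k.2.1 (J k) / 2 - l} with hbad
  set I := Finset.range K ×ˢ Finset.range K ×ˢ Finset.Icc 1 K ×ˢ Finset.range K with hI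
  have hsub : {ω | ¬ ArrivalsBalanced K (5 * l + 2) (fun j => T j ω)} ⊆ ⋃ k ∈ I, bad k := by
    intro ω hω
    by_contra hnot
    apply hω
    intro σ hσ e he s hs r hr
    have hk : (σ, e, s, r) ∈ I := by
      simp only [hI, Finset.mem_product, Finset.mem_range, Finset.mem_Icc]
      omega
    have h1 : ω ∉ bad (σ, e, s, r) := fun h => hnot (Set.mem_biUnion hk h)
    simp only [hbad, hJ, Set.mem_union, Set.mem_ofPred_eq, not_or, not_le] at h1
    obtain ⟨h1, h2⟩ := h1
    have h3 : m e (Finset.Icc σ e) ≤ s *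
        (m e ((Finset.Icc σ e).filter (fun j => (j - σ) % s = r)) + 1) := by
      refine sum_le_mul_sum_filter_mod hr (fun _ => measureReal_nonneg)
        (fun _ => measureReal_le_one) fun j j' _ hj _ => ?_
      exact measureReal_mono (Set.Iic_subset_Iic.2 (Nat.sub_le_sub_left hj e))
    have h4 := card_arrived_eq_numBelow (T := T) σ e (fun _ => True) ω
    simp only [Finset.filter_true] at h4
    rw [h4, card_arrived_eq_numBelow]
    have hs1 : (1 : ℝ) ≤ s := by exact_mod_cast Nat.one_le_of_lt hr
    have h5 : (s : ℝ) * m e ((Finset.Icc σ e).filter (fun j => (j - σ) % s = r)) ≤ s *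
        (2 * (numBelow T ((Finset.Icc σ e).filter (fun j => (j - σ) % s = r))
          (fun j => e - j) ω + l)) :=
      mul_le_mul_of_nonneg_left (by linarith) (by linarith)
    nlinarith
  calc P.real {ω | ¬ ArrivalsBalanced K (5 * l + 2) (fun j => T j ω)}
      ≤ P.real (⋃ k ∈ I, bad k) := measureReal_mono hsub (measure_ne_top _ _)
    _ ≤ ∑ k ∈ I, P.real (bad k) := measureReal_biUnion_finset_le _ _
    _ ≤ ∑ k ∈ I, (Real.exp (-l) + Real.exp (-l)) := by
        refine Finset.sum_le_sum fun k _ => (measureReal_union_le _ _).trans (add_le_add ?_ ?_)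
        · exact measureReal_ge_numBelow_le hT hlaw hind _ _ _
        · exact measureReal_le_numBelow_le hT hlaw hind _ _ _
    _ = 2 * (K : ℝ) ^ 4 * Real.exp (-l) := by
        rw [Finset.sum_const, nsmul_eq_mul, hI]
        simp only [Finset.card_product, Finset.card_range, Nat.card_Icc, Nat.add_sub_cancel]
        push_cast
        ring

/-- In every window the number of arrivals is at least a constant fraction of the number of rounds
which are older than the threshold `u`. -/
lemma measureReal_not_window_le (hT : ∀ t, Measurable (T t)) (hlaw : ∀ t, P.map (T t) = ρ)
    (hind : iIndepFun T P) (K u : ℕ) {q : ℝ} (hq0 : 0 ≤ q) (hq : q ≤ ρ.real (Set.Iic u)) (l : ℝ) :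
    P.real {ω | ¬ ∀ σ < K, ∀ e < K, σ ≤ e → q / 2 * ((e : ℝ) + 1 - σ)
      ≤ (arrived (fun j => T j ω) σ e).card + (q / 2 * u + l)} ≤ (K : ℝ) ^ 2 * Real.exp (-l) := by
  -- Rounds of the window that are at least u old at time e have arrived once their delay is at most
  -- u. The at most u younger rounds cause the loss qu/2.
  set J : ℕ × ℕ → Finset ℕ := fun k => Finset.Ico k.1 (k.2 + 1 - u) with hJ
  set bad : ℕ × ℕ → Set Ω := fun k =>
    {ω | numBelow T (J k) (fun _ => u) ω ≤ (∑ j ∈ J k, ρ.real (Set.Iic u)) / 2 - l} with hbad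
  set I := Finset.range K ×ˢ Finset.range K with hI
  have hsub : {ω | ¬ ∀ σ < K, ∀ e < K, σ ≤ e → q / 2 * ((e : ℝ) + 1 - σ)
      ≤ (arrived (fun j => T j ω) σ e).card + (q / 2 * u + l)} ⊆ ⋃ k ∈ I, bad k := by
    intro ω hω
    by_contra hnot
    apply hω
    intro σ hσ e he hσe
    have hk : (σ, e) ∈ I := by
      simp only [hI, Finset.mem_product, Finset.mem_range]
      exact ⟨hσ, he⟩
    have h1 : ω ∉ bad (σ, e) := fun h => hnot (Set.mem_biUnion hk h)
    simp only [hbad, hJ, Set.mem_ofPred_eq, not_le, Finset.sum_const, Nat.card_Ico,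
      nsmul_eq_mul, numBelow_eq_card] at h1
    have h2 : (((Finset.Ico σ (e + 1 - u)).filter (fun j => T j ω ≤ u)).card : ℝ)
        ≤ (arrived (fun j => T j ω) σ e).card := by
      gcongr
      intro j hj
      simp only [Finset.mem_filter, Finset.mem_Ico, arrived, Finset.mem_Icc] at hj ⊢
      omega
    have h3 : (e : ℝ) + 1 - σ - u ≤ ((e + 1 - u - σ : ℕ) : ℝ) := by
      rw [sub_le_iff_le_add, sub_le_iff_le_add]
      exact_mod_cast (by omega)
    have h4 : ((e : ℝ) + 1 - σ - u) * q ≤ ((e + 1 - u - σ : ℕ) : ℝ) * ρ.real (Set.Iic u) :=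
      (mul_le_mul_of_nonneg_right h3 hq0).trans (mul_le_mul_of_nonneg_left hq (Nat.cast_nonneg _))
    linarith
  calc P.real _ ≤ P.real (⋃ k ∈ I, bad k) := measureReal_mono hsub (measure_ne_top _ _)
    _ ≤ ∑ k ∈ I, P.real (bad k) := measureReal_biUnion_finset_le _ _
    _ ≤ ∑ k ∈ I, Real.exp (-l) := Finset.sum_le_sum fun k _ =>
        measureReal_le_numBelow_le hT hlaw hind (J k) (fun _ => u) l
    _ = (K : ℝ) ^ 2 * Real.exp (-l) := by
        rw [Finset.sum_const, nsmul_eq_mul, hI]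
        simp only [Finset.card_product, Finset.card_range]
        push_cast
        ring

/-- At every time the number of the rounds with delay at most `u` is at least a constant fraction
of the number of rounds. -/
lemma measureReal_not_prefix_le (hT : ∀ t, Measurable (T t)) (hlaw : ∀ t, P.map (T t) = ρ)
    (hind : iIndepFun T P) (K u : ℕ) {q : ℝ} (hq : q ≤ ρ.real (Set.Iic u)) (l : ℝ) :
    P.real {ω | ¬ ∀ t < K, q / 2 * (t : ℝ) - l
      ≤ (((Finset.range t).filter (fun j => T j ω ≤ u)).card : ℝ)} ≤ K * Real.exp (-l) := by
  set bad : ℕ → Set Ω := fun t => {ω | numBelow T (Finset.range t) (fun _ => u) ω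
    ≤ (∑ j ∈ Finset.range t, ρ.real (Set.Iic u)) / 2 - l} with hbad
  have hsub : {ω | ¬ ∀ t < K, q / 2 * (t : ℝ) - l
      ≤ (((Finset.range t).filter (fun j => T j ω ≤ u)).card : ℝ)}
      ⊆ ⋃ t ∈ Finset.range K, bad t := by
    intro ω hω
    by_contra hnot
    apply hω
    intro t ht
    have h1 : ω ∉ bad t := fun h => hnot (Set.mem_biUnion (Finset.mem_range.2 ht) h)
    simp only [hbad, Set.mem_ofPred_eq, not_le, Finset.sum_const, Finset.card_range,
      nsmul_eq_mul, numBelow_eq_card] at h1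
    have h2 : (t : ℝ) * q ≤ t * ρ.real (Set.Iic u) :=
      mul_le_mul_of_nonneg_left hq (Nat.cast_nonneg _)
    linarith
  calc P.real _ ≤ P.real (⋃ t ∈ Finset.range K, bad t) := measureReal_mono hsub (measure_ne_top _ _)
    _ ≤ ∑ t ∈ Finset.range K, P.real (bad t) := measureReal_biUnion_finset_le _ _
    _ ≤ ∑ t ∈ Finset.range K, Real.exp (-l) := Finset.sum_le_sum fun t _ =>
        measureReal_le_numBelow_le hT hlaw hind (Finset.range t) (fun _ => u) l
    _ = K * Real.exp (-l) := by simp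

end Arrivals

/-! ### Concentration of the rewards -/

section Rewards

open scoped ENNReal

/-- Conditioning on a countably valued variable, done by summing over its fibres. -/
lemma measure_le_of_forall_fiber {Ω ι : Type*} [MeasurableSpace Ω] {P : Measure Ω}
    [IsProbabilityMeasure P] [Countable ι] [MeasurableSpace ι] [MeasurableSingletonClass ι]
    {D : Ω → ι} (hD : Measurable D) {B : Set Ω} {δ : ℝ≥0∞}
    (h : ∀ d, P (B ∩ D ⁻¹' {d}) ≤ δ * P (D ⁻¹' {d})) : P B ≤ δ := by
  have h1 : ∑' d, P (D ⁻¹' {d}) = 1 := by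
    rw [← measure_iUnion]
    · have : ⋃ d, D ⁻¹' {d} = Set.univ := by
        ext ω; simp
      rw [this, measure_univ]
    · intro i j hij
      exact (Set.disjoint_singleton.2 hij).preimage D
    · exact fun d => hD (measurableSet_singleton d)
  calc P B ≤ P (⋃ d, B ∩ D ⁻¹' {d}) := measure_mono fun ω hω => by
        simp only [Set.mem_iUnion]
        exact ⟨D ω, hω, rfl⟩
    _ ≤ ∑' d, P (B ∩ D ⁻¹' {d}) := measure_iUnion_le _
    _ ≤ ∑' d, δ * P (D ⁻¹' {d}) := ENNReal.tsum_le_tsum h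
    _ = δ := by rw [ENNReal.tsum_mul_left, h1, mul_one]

/-- A function of the coordinates before `t` is independent of the coordinate `t`. -/
lemma lintegral_past_mul {Ω E : Type*} [MeasurableSpace Ω] [MeasurableSpace E] [Inhabited E]
    {P : Measure Ω} {ξ : ℕ → Ω → E} (hξ : ∀ t, Measurable (ξ t)) (hind : iIndepFun ξ P) (t : ℕ)
    {φ : (ℕ → E) → ℝ≥0∞} (hφ : Measurable φ) (hpast : ∀ e e', (∀ j < t, e j = e' j) → φ e = φ e')
    {ψ : E → ℝ≥0∞} (hψ : Measurable ψ) :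
    ∫⁻ ω, φ (fun j => ξ j ω) * ψ (ξ t ω) ∂P
      = (∫⁻ ω, φ (fun j => ξ j ω) ∂P) * ∫⁻ ω, ψ (ξ t ω) ∂P := by
  set ext : ((i : Finset.range t) → E) → ℕ → E :=
    fun f j => if h : j ∈ Finset.range t then f ⟨j, h⟩ else default with hext
  have hextm : Measurable ext := by
    refine measurable_pi_iff.2 fun j => ?_
    by_cases h : j ∈ Finset.range t
    · simp only [hext, dif_pos h]
      exact measurable_pi_apply _
    · simp only [hext, dif_neg h]
      exact measurable_const
  have h1 : ∀ ω, φ (fun j => ξ j ω) = φ (ext (fun i : Finset.range t => ξ i ω)) := by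
    intro ω
    refine hpast _ _ fun j hj => ?_
    simp only [hext, dif_pos (Finset.mem_range.2 hj)]
  have hdis : Disjoint (Finset.range t) {t} := by simp
  have h2 := (hind.indepFun_finset (Finset.range t) {t} hdis hξ).comp (hφ.comp hextm)
    (hψ.comp (measurable_pi_apply (⟨t, Finset.mem_singleton_self t⟩ : ({t} : Finset ℕ))))
  simp_rw [h1]
  exact lintegral_mul_eq_lintegral_mul_lintegral_of_indepFun
    ((hφ.comp hextm).comp (measurable_pi_iff.2 fun i => hξ i)) (hψ.comp (hξ t)) h2

variable {Ω : Type*} [MeasurableSpace Ω] {P : Measure Ω} {A : ℕ}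
  {ν : Fin A → Measure ℝ} {ρ : Measure ℕ} {X : ℕ → Fin A → Ω → ℝ} {T : ℕ → Ω → ℕ}

lemma IsEnvironment.ae_mem_Icc (h : IsEnvironment P ν ρ X T)
    (hν : ∀ a, ν a (Set.Icc (0 : ℝ) 1)ᶜ = 0) (t : ℕ) (a : Fin A) :
    ∀ᵐ ω ∂P, X t a ω ∈ Set.Icc (0 : ℝ) 1 := by
  have h1 := hν a
  rw [← h.law_reward t a, Measure.map_apply (h.measurable_reward t a) measurableSet_Icc.compl] at h1
  exact h1

lemma IsEnvironment.integral_reward (h : IsEnvironment P ν ρ X T) (t : ℕ) (a : Fin A) :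
    ∫ ω, X t a ω ∂P = meanReward ν a := by
  rw [meanReward, ← h.law_reward t a,
    integral_map (f := fun y => y) (h.measurable_reward t a).aemeasurable aestronglyMeasurable_id]

lemma IsEnvironment.iIndepFun_delay (h : IsEnvironment P ν ρ X T) : iIndepFun T P :=
  h.indep_rounds.comp (fun _ y => y.2) fun _ => measurable_snd

lemma measurable_truncated_delay (h : IsEnvironment P ν ρ X T) (K : ℕ) :
    Measurable fun ω => fun j : Fin K => T j ω :=
  measurable_pi_iff.2 fun j => h.measurable_delay j

lemma IsEnvironment.measure_delay_eq (h : IsEnvironment P ν ρ X T) (d : ℕ → ℕ) (K : ℕ) :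
    P {ω | ∀ j < K, T j ω = d j} = ∏ j ∈ Finset.range K, ρ {d j} := by
  have h1 := h.iIndepFun_delay.measure_inter_preimage_eq_mul (Finset.range K)
    (sets := fun j => {d j}) fun _ _ => measurableSet_singleton _
  have h2 : {ω | ∀ j < K, T j ω = d j} = ⋂ j ∈ Finset.range K, T j ⁻¹' {d j} := by
    ext ω; simp
  rw [h2, h1]
  refine Finset.prod_congr rfl fun j _ => ?_
  rw [← h.law_delay j, Measure.map_apply (h.measurable_delay j) (measurableSet_singleton _)]

variable [IsProbabilityMeasure P]

lemma IsEnvironment.meanReward_mem (h : IsEnvironment P ν ρ X T)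
    (hν : ∀ a, ν a (Set.Icc (0 : ℝ) 1)ᶜ = 0) (a : Fin A) :
    0 ≤ meanReward ν a ∧ meanReward ν a ≤ 1 := by
  have hae := h.ae_mem_Icc hν 0 a
  rw [← h.integral_reward 0 a]
  refine ⟨integral_nonneg_of_ae (hae.mono fun ω hω => hω.1), ?_⟩
  have hint : Integrable (X 0 a) P :=
    Integrable.of_mem_Icc 0 1 (h.measurable_reward 0 a).aemeasurable hae
  calc ∫ ω, X 0 a ω ∂P ≤ ∫ ω, (1 : ℝ) ∂P :=
        integral_mono_ae hint (integrable_const _) (hae.mono fun ω hω => hω.2)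
    _ = 1 := by simp

/-- Hoeffding's lemma: a variable with values in [0, 1] is sub-Gaussian with variance proxy 1/4. -/
lemma IsEnvironment.lintegral_exp_le (h : IsEnvironment P ν ρ X T)
    (hν : ∀ a, ν a (Set.Icc (0 : ℝ) 1)ᶜ = 0) (t : ℕ) (a : Fin A) (l : ℝ) :
    ∫⁻ ω, ENNReal.ofReal (Real.exp (l * (X t a ω - meanReward ν a) - l ^ 2 / 8)) ∂P ≤ 1 := by
  have hsg := hasSubgaussianMGF_of_mem_Icc (h.measurable_reward t a).aemeasurable
    (h.ae_mem_Icc hν t a)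
  rw [h.integral_reward t a] at hsg
  have h1 : ∀ ω, Real.exp (l * (X t a ω - meanReward ν a) - l ^ 2 / 8)
      = Real.exp (l * (X t a ω - meanReward ν a)) * Real.exp (-(l ^ 2 / 8)) := fun ω => by
    rw [← Real.exp_add, sub_eq_add_neg]
  simp_rw [h1]
  rw [← ofReal_integral_eq_lintegral_ofReal ((hsg.integrable_exp_mul l).mul_const _)
    (.of_forall fun ω => by positivity), integral_mul_const]
  refine ENNReal.ofReal_le_one.2 ?_
  have h2 := hsg.mgf_le l
  have h3 : ((((‖(1 : ℝ) - 0‖₊ / 2) ^ 2 : NNReal) : ℝ) * l ^ 2 / 2) = l ^ 2 / 8 := by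
    push_cast
    simp
    ring
  rw [h3] at h2
  calc _ ≤ Real.exp (l ^ 2 / 8) * Real.exp (-(l ^ 2 / 8)) :=
        mul_le_mul_of_nonneg_right h2 (Real.exp_nonneg _)
    _ = 1 := by rw [← Real.exp_add, add_neg_cancel, Real.exp_zero]

open Classical in
/-- The factor of round `j` in the exponential supermartingale for arm `i`, restricted to the event
that the delays are `d`. -/
def expFactor (ν : Fin A → Measure ℝ) (a : ℕ → (ℕ → Fin A → ℝ) → Fin A) (d : ℕ → ℕ) (I : Finset ℕ)
    (i : Fin A) (l : ℝ) (j : ℕ) (e : ℕ → (Fin A → ℝ) × ℕ) : ℝ≥0∞ :=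
  if (e j).2 = d j then
    if j ∈ I ∧ a j (fun k => (e k).1) = i then
      ENNReal.ofReal (Real.exp (l * ((e j).1 i - meanReward ν i) - l ^ 2 / 8))
    else 1
  else 0

lemma measurable_expFactor {a : ℕ → (ℕ → Fin A → ℝ) → Fin A} (ha : ∀ j, Measurable (a j))
    (d : ℕ → ℕ) (I : Finset ℕ) (i : Fin A) (l : ℝ) (j : ℕ) :
    Measurable (expFactor ν a d I i l j) := by
  have h1 : Measurable fun e : ℕ → (Fin A → ℝ) × ℕ => e j := measurable_pi_apply j
  have h2 : Measurable fun e : ℕ → (Fin A → ℝ) × ℕ => fun k => (e k).1 :=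
    measurable_pi_iff.2 fun k => (measurable_pi_apply k).fst
  have h3 : Measurable fun e : ℕ → (Fin A → ℝ) × ℕ => (e j).1 i :=
    (measurable_pi_apply i).comp h1.fst
  unfold expFactor
  refine Measurable.ite (h1.snd (measurableSet_singleton _)) (Measurable.ite ?_ ?_
    measurable_const) measurable_const
  · exact (MeasurableSet.const _).inter (((ha j).comp h2) (measurableSet_singleton i))
  · exact (Real.measurable_exp.comp (((h3.sub_const _).const_mul l).sub_const _)).ennreal_ofReal

/-- Whether round t counts for arm i is decided by earlier rewards. The new factor is thus the delay
indicator, with or without the exponential. Either has mean at most the probability of the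
prescribed delay, because delay and rewards of one round are independent. -/
lemma lintegral_prod_expFactor_le (h : IsEnvironment P ν ρ X T)
    (hν : ∀ a, ν a (Set.Icc (0 : ℝ) 1)ᶜ = 0) {a : ℕ → (ℕ → Fin A → ℝ) → Fin A}
    (ha : ∀ j, Measurable (a j)) (hpast : ∀ t x x', (∀ j < t, x j = x' j) → a t x = a t x')
    (d : ℕ → ℕ) (I : Finset ℕ) (i : Fin A) (l : ℝ) (t : ℕ) :
    ∫⁻ ω, ∏ j ∈ Finset.range t, expFactor ν a d I i l j (fun k => (fun b => X k b ω, T k ω)) ∂P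
      ≤ ∏ j ∈ Finset.range t, ρ {d j} := by
  induction t with
  | zero => simp
  | succ t ih =>
    set ξ : ℕ → Ω → (Fin A → ℝ) × ℕ := fun k ω => (fun b => X k b ω, T k ω) with hξ
    have hξm : ∀ k, Measurable (ξ k) := fun k =>
      (measurable_pi_iff.2 fun b => h.measurable_reward k b).prodMk (h.measurable_delay k)
    set W : (ℕ → (Fin A → ℝ) × ℕ) → ℝ≥0∞ :=
      fun e => ∏ j ∈ Finset.range t, expFactor ν a d I i l j e with hW
    have hWm : Measurable W := Finset.measurable_fun_prod _ fun j _ => measurable_expFactor ha d I i l j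
    have hWpast : ∀ e e', (∀ j < t, e j = e' j) → W e = W e' := by
      intro e e' he
      refine Finset.prod_congr rfl fun j hj => ?_
      have hj' := Finset.mem_range.1 hj
      rw [expFactor, expFactor, he j hj', hpast j (fun k => (e k).1) (fun k => (e' k).1)
        fun k hk => by rw [he k (hk.trans hj')]]
    classical
    set c : (ℕ → (Fin A → ℝ) × ℕ) → Prop := fun e => t ∈ I ∧ a t (fun k => (e k).1) = i with hc
    have hcm : MeasurableSet {e | c e} := by
      have h2 : Measurable fun e : ℕ → (Fin A → ℝ) × ℕ => fun k => (e k).1 :=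
        measurable_pi_iff.2 fun k => (measurable_pi_apply k).fst
      exact (MeasurableSet.const _).inter (((ha t).comp h2) (measurableSet_singleton i))
    have hcpast : ∀ e e' : ℕ → (Fin A → ℝ) × ℕ, (∀ j < t, e j = e' j) → (c e ↔ c e') := by
      intro e e' he
      simp only [hc]
      rw [hpast t (fun k => (e k).1) (fun k => (e' k).1) fun k hk => by rw [he k hk]]
    set V1 : (Fin A → ℝ) × ℕ → ℝ≥0∞ := fun y => if y.2 = d t then
      ENNReal.ofReal (Real.exp (l * (y.1 i - meanReward ν i) - l ^ 2 / 8)) else 0 with hV1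
    set V2 : (Fin A → ℝ) × ℕ → ℝ≥0∞ := fun y => if y.2 = d t then 1 else 0 with hV2
    have hdm : MeasurableSet {y : (Fin A → ℝ) × ℕ | y.2 = d t} :=
      measurable_snd (measurableSet_singleton (d t))
    have hyi : Measurable fun y : Fin A → ℝ => y i := measurable_pi_apply i
    have hY : Measurable fun y : Fin A → ℝ =>
        ENNReal.ofReal (Real.exp (l * (y i - meanReward ν i) - l ^ 2 / 8)) :=
      (Real.measurable_exp.comp (((hyi.sub_const _).const_mul l).sub_const _)).ennreal_ofReal
    have hV1m : Measurable V1 := Measurable.ite hdm (hY.comp measurable_fst) measurable_const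
    have hV2m : Measurable V2 := Measurable.ite hdm measurable_const measurable_const
    have hI2 : ∫⁻ ω, V2 (ξ t ω) ∂P = ρ {d t} := by
      have : ∀ ω, V2 (ξ t ω) = Set.indicator (T t ⁻¹' {d t}) 1 ω := fun ω => by
        simp [hV2, hξ, Set.indicator_apply]
      simp_rw [this]
      rw [lintegral_indicator_one (h.measurable_delay t (measurableSet_singleton _)),
        ← h.law_delay t, Measure.map_apply (h.measurable_delay t) (measurableSet_singleton _)]
    have hI1 : ∫⁻ ω, V1 (ξ t ω) ∂P ≤ ρ {d t} := by
      have hg : Measurable fun n : ℕ => if n = d t then (1 : ℝ≥0∞) else 0 := measurable_of_countable _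
      have h1 := (h.indep_delay t).comp hY hg
      have h2 : ∀ ω, V1 (ξ t ω)
          = ENNReal.ofReal (Real.exp (l * (X t i ω - meanReward ν i) - l ^ 2 / 8))
            * (if T t ω = d t then (1 : ℝ≥0∞) else 0) := fun ω => by
        simp [hV1, hξ]
      have h3 : ∫⁻ ω, (if T t ω = d t then (1 : ℝ≥0∞) else 0) ∂P = ρ {d t} := hI2
      simp_rw [h2]
      have h4 := lintegral_mul_eq_lintegral_mul_lintegral_of_indepFun
        (hY.comp (measurable_pi_iff.2 fun b => h.measurable_reward t b))
        (hg.comp (h.measurable_delay t)) h1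
      refine (h4.trans_le (mul_le_mul' (h.lintegral_exp_le hν t i l) h3.le)).trans ?_
      rw [one_mul]
    have hsplit : ∀ ω, ∏ j ∈ Finset.range (t + 1), expFactor ν a d I i l j (fun k => ξ k ω)
        = (W (fun k => ξ k ω) * if c (fun k => ξ k ω) then 1 else 0) * V1 (ξ t ω)
          + (W (fun k => ξ k ω) * if c (fun k => ξ k ω) then 0 else 1) * V2 (ξ t ω) := by
      intro ω
      rw [Finset.prod_range_succ]
      by_cases hcc : c (fun k => ξ k ω)
      · rw [if_pos hcc, if_pos hcc, mul_one, mul_zero, zero_mul, add_zero]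
        congr 1
        simp only [hc] at hcc
        simp only [expFactor, if_pos hcc, hV1]
      · rw [if_neg hcc, if_neg hcc, mul_one, mul_zero, zero_mul, zero_add]
        congr 1
        simp only [hc] at hcc
        simp only [expFactor, if_neg hcc, hV2]
    have hW1m : Measurable fun e => W e * if c e then (1 : ℝ≥0∞) else 0 :=
      hWm.mul (Measurable.ite hcm measurable_const measurable_const)
    have hW2m : Measurable fun e => W e * if c e then (0 : ℝ≥0∞) else 1 :=
      hWm.mul (Measurable.ite hcm measurable_const measurable_const)
    have hξall : Measurable fun ω => fun k => ξ k ω := measurable_pi_iff.2 hξm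
    have hm1 : Measurable fun ω => W (fun k => ξ k ω) * if c (fun k => ξ k ω) then (1 : ℝ≥0∞) else 0 :=
      hW1m.comp hξall
    have hm2 : Measurable fun ω =>
        (W (fun k => ξ k ω) * if c (fun k => ξ k ω) then (1 : ℝ≥0∞) else 0) * V1 (ξ t ω) :=
      hm1.mul (hV1m.comp (hξm t))
    have hsum : ∀ ω, (W (fun k => ξ k ω) * if c (fun k => ξ k ω) then (1 : ℝ≥0∞) else 0)
        + (W (fun k => ξ k ω) * if c (fun k => ξ k ω) then (0 : ℝ≥0∞) else 1)
        = W (fun k => ξ k ω) := fun ω => by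
      split_ifs <;> simp
    calc ∫⁻ ω, ∏ j ∈ Finset.range (t + 1), expFactor ν a d I i l j (fun k => ξ k ω) ∂P
        = (∫⁻ ω, W (fun k => ξ k ω) * (if c (fun k => ξ k ω) then 1 else 0) ∂P)
              * ∫⁻ ω, V1 (ξ t ω) ∂P
          + (∫⁻ ω, W (fun k => ξ k ω) * (if c (fun k => ξ k ω) then 0 else 1) ∂P)
              * ∫⁻ ω, V2 (ξ t ω) ∂P := by
          simp_rw [hsplit]
          rw [lintegral_add_left hm2]
          exact congrArg₂ (· + ·)
            (lintegral_past_mul hξm h.indep_rounds t hW1m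
              (fun e e' he => by simp only [hWpast e e' he, hcpast e e' he]) hV1m)
            (lintegral_past_mul hξm h.indep_rounds t hW2m
              (fun e e' he => by simp only [hWpast e e' he, hcpast e e' he]) hV2m)
      _ ≤ (∫⁻ ω, W (fun k => ξ k ω) * (if c (fun k => ξ k ω) then 1 else 0) ∂P) * ρ {d t}
          + (∫⁻ ω, W (fun k => ξ k ω) * (if c (fun k => ξ k ω) then 0 else 1) ∂P) * ρ {d t} := by
          gcongr
          exact hI2.le
      _ = (∫⁻ ω, W (fun k => ξ k ω) ∂P) * ρ {d t} := by
          rw [← add_mul, ← lintegral_add_left hm1]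
          simp_rw [hsum]
      _ ≤ (∏ j ∈ Finset.range t, ρ {d j}) * ρ {d t} := by gcongr
      _ = ∏ j ∈ Finset.range (t + 1), ρ {d j} := (Finset.prod_range_succ _ _).symm

/-- A Chernoff bound for the centered reward sum of arm `i` over the rounds of a fixed set `I`, on
the event that the delays are `d`. -/
lemma measure_exp_tail_le (h : IsEnvironment P ν ρ X T)
    (hν : ∀ a, ν a (Set.Icc (0 : ℝ) 1)ᶜ = 0) {a : ℕ → (ℕ → Fin A → ℝ) → Fin A}
    (ha : ∀ j, Measurable (a j)) (hpast : ∀ t x x', (∀ j < t, x j = x' j) → a t x = a t x')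
    (d : ℕ → ℕ) {K : ℕ} {I : Finset ℕ} (hI : I ⊆ Finset.range K) (i : Fin A) (l z : ℝ) (n : ℕ) :
    P ({ω | (I.filter (fun j => a j (fun k b => X k b ω) = i)).card = n ∧
        z ≤ l * ∑ j ∈ I.filter (fun j => a j (fun k b => X k b ω) = i), (X j i ω - meanReward ν i)}
      ∩ {ω | ∀ j < K, T j ω = d j})
      ≤ ENNReal.ofReal (Real.exp (-(z - l ^ 2 / 8 * n))) * P {ω | ∀ j < K, T j ω = d j} := by
  set B := {ω | (I.filter (fun j => a j (fun k b => X k b ω) = i)).card = n ∧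
        z ≤ l * ∑ j ∈ I.filter (fun j => a j (fun k b => X k b ω) = i), (X j i ω - meanReward ν i)}
      ∩ {ω | ∀ j < K, T j ω = d j} with hB
  set W : Ω → ℝ≥0∞ := fun ω => ∏ j ∈ Finset.range K,
    expFactor ν a d I i l j (fun k => (fun b => X k b ω, T k ω)) with hW
  have hξm : Measurable fun ω => fun k => ((fun b => X k b ω : Fin A → ℝ), T k ω) :=
    measurable_pi_iff.2 fun k =>
      (measurable_pi_iff.2 fun b => h.measurable_reward k b).prodMk (h.measurable_delay k)
  have hWm : Measurable W := Finset.measurable_fun_prod _ fun j _ =>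
    (measurable_expFactor ha d I i l j).comp hξm
  -- On B all delay indicators equal 1 and exactly n factors are exponentials, so W is explicit and
  -- Markov's inequality applies.
  have hBW : B ⊆ {ω | ENNReal.ofReal (Real.exp (z - l ^ 2 / 8 * n)) ≤ W ω} := by
    rintro ω ⟨⟨hcard, hz⟩, hd⟩
    have h1 : W ω = ENNReal.ofReal (Real.exp (l * ∑ j ∈ I.filter
        (fun j => a j (fun k b => X k b ω) = i), (X j i ω - meanReward ν i) - l ^ 2 / 8 * n)) := by
      have h2 : W ω = ∏ j ∈ Finset.range K, if j ∈ I.filter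
          (fun j => a j (fun k b => X k b ω) = i) then
          ENNReal.ofReal (Real.exp (l * (X j i ω - meanReward ν i) - l ^ 2 / 8)) else 1 := by
        refine Finset.prod_congr rfl fun j hj => ?_
        simp only [expFactor, if_pos (hd j (Finset.mem_range.1 hj)), Finset.mem_filter]
      rw [h2, Finset.prod_ite_mem, Finset.inter_eq_right.2 ((Finset.filter_subset _ _).trans hI),
        ← ENNReal.ofReal_prod_of_nonneg fun _ _ => Real.exp_nonneg _, ← Real.exp_sum,
        Finset.sum_sub_distrib, ← Finset.mul_sum, Finset.sum_const, hcard, nsmul_eq_mul,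
        mul_comm (n : ℝ)]
    simp only [Set.mem_ofPred_eq]
    rw [h1]
    gcongr
  have h3 := mul_meas_ge_le_lintegral (μ := P) hWm (ENNReal.ofReal (Real.exp (z - l ^ 2 / 8 * n)))
  have h4 := lintegral_prod_expFactor_le h hν ha hpast d I i l K
  rw [← h.measure_delay_eq d K] at h4
  have h5 : ENNReal.ofReal (Real.exp (-(z - l ^ 2 / 8 * n)))
      * ENNReal.ofReal (Real.exp (z - l ^ 2 / 8 * n)) = 1 := by
    rw [← ENNReal.ofReal_mul (Real.exp_nonneg _), ← Real.exp_add, neg_add_cancel, Real.exp_zero,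
      ENNReal.ofReal_one]
  calc P B = ENNReal.ofReal (Real.exp (-(z - l ^ 2 / 8 * n)))
        * (ENNReal.ofReal (Real.exp (z - l ^ 2 / 8 * n)) * P B) := by
        rw [← mul_assoc, h5, one_mul]
    _ ≤ _ := by
        refine mul_le_mul' le_rfl (le_trans ?_ (h3.trans h4))
        exact mul_le_mul' le_rfl (measure_mono hBW)

variable [NeZero A]

/-- On a fibre of the first K delays the observed sets are deterministic, so `measure_exp_tail_le`
applies. The union over t < K, 1 ≤ n ≤ K, the arms and two signs gives the factor 2K²A. -/
lemma measure_not_rewardsConcentrated_le (h : IsEnvironment P ν ρ X T)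
    (hν : ∀ a, ν a (Set.Icc (0 : ℝ) 1)ᶜ = 0) {γ : ℝ} (hγ : 0 ≤ γ) (K : ℕ) :
    P {ω | ¬ RewardsConcentrated A K γ ν (fun j b => X j b ω) (fun j => T j ω)}
      ≤ 2 * (K : ℝ≥0∞) ^ 2 * A
        * ENNReal.ofReal (Real.exp (-(γ / 2 * Real.log ((K : ℝ) * (A : ℝ))))) := by
  set L := Real.log ((K : ℝ) * (A : ℝ)) with hL
  have hL0 : 0 ≤ L := log_mul_nonneg A K
  refine measure_le_of_forall_fiber (measurable_truncated_delay h K) fun d₀ => ?_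
  set d : ℕ → ℕ := fun j => if hj : j < K then d₀ ⟨j, hj⟩ else 0 with hd
  have hfib : (fun ω => fun j : Fin K => T j ω) ⁻¹' {d₀} = {ω | ∀ j < K, T j ω = d j} := by
    ext ω
    simp only [Set.mem_preimage, Set.mem_singleton_iff, Set.mem_ofPred_eq, funext_iff]
    constructor
    · intro hω j hj
      rw [hd]
      simp only [dif_pos hj]
      exact hω ⟨j, hj⟩
    · intro hω j
      have := hω j j.2
      rw [hd] at this
      simpa only [dif_pos j.2] using this
  rw [hfib]
  set a : ℕ → (ℕ → Fin A → ℝ) → Fin A := fun j x => (BaSE A K γ).pulledArm x d j with ha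
  have ham : ∀ j, Measurable (a j) := measurable_pulledArm K γ d
  have hpast : ∀ t x x', (∀ j < t, x j = x' j) → a t x = a t x' := fun t x x' hx =>
    (BaSE A K γ).pulledArm_congr hx fun _ _ => rfl
  set O : ℕ → Finset ℕ := fun t => (BaSE A K γ).observed (fun _ _ => 0) d t with hO
  set bad : ℕ → ℕ → Fin A → ℝ → Set Ω := fun t n i l =>
    {ω | ((O t).filter (fun j => a j (fun k b => X k b ω) = i)).card = n ∧
      γ * L ≤ l * ∑ j ∈ (O t).filter (fun j => a j (fun k b => X k b ω) = i),
        (X j i ω - meanReward ν i)} ∩ {ω | ∀ j < K, T j ω = d j} with hbad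
  have hOK : ∀ t < K, O t ⊆ Finset.range K := fun t ht =>
    ((BaSE A K γ).observed_subset _ d t).trans
      (Finset.range_subset_range.2 (((BaSE A K γ).start_le _ d t).trans ht.le))
  set E := {ω | ∀ j < K, T j ω = d j} with hE
  -- The optimal Chernoff exponent for a deviation of half the radius: the linear term is γL and the
  -- quadratic correction γL/2.
  set rate : ℕ → ℝ := fun n => 2 * Real.sqrt (γ * L / n) with hrate
  have hrate2 : ∀ n : ℕ, 0 < n → rate n ^ 2 / 8 * n = γ / 2 * L := by
    intro n hn
    have hn' : (0 : ℝ) < n := by exact_mod_cast hn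
    rw [hrate]
    simp only
    rw [mul_pow, Real.sq_sqrt (by positivity)]
    field_simp
    ring
  have hbound : ∀ t < K, ∀ n : ℕ, 0 < n → ∀ i, ∀ l, l ^ 2 = rate n ^ 2 →
      P (bad t n i l) ≤ ENNReal.ofReal (Real.exp (-(γ / 2 * L))) * P E := by
    intro t ht n hn i l hl
    refine (measure_exp_tail_le h hν ham hpast d (hOK t ht) i l (γ * L) n).trans_eq ?_
    rw [hl, hrate2 n hn]
    congr 4
    ring
  have hsub : {ω | ¬ RewardsConcentrated A K γ ν (fun j b => X j b ω) (fun j => T j ω)} ∩ E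
      ⊆ ⋃ k ∈ (Finset.range K ×ˢ Finset.Icc 1 K ×ˢ (Finset.univ : Finset (Fin A))),
        (bad k.1 k.2.1 k.2.2 (rate k.2.1) ∪ bad k.1 k.2.1 k.2.2 (-rate k.2.1)) := by
    rintro ω ⟨hω, hωE⟩
    by_contra hnot
    apply hω
    intro t ht i hpos
    have hst : (BaSE A K γ).state (fun j b => X j b ω) (fun j => T j ω) t
        = (BaSE A K γ).state (fun j b => X j b ω) d t :=
      (BaSE A K γ).state_congr (fun _ _ => rfl) fun j hj => hωE j (hj.trans ht)
    rw [hst] at hpos ⊢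
    rw [average_eq]
    rw [(BaSE A K γ).sum_hist, (BaSE_clock K γ _ d (fun _ _ => 0) t).2.2] at hpos ⊢
    rw [count_map] at hpos ⊢
    rw [rewardSum_map]
    set F := (O t).filter (fun j => a j (fun k b => X k b ω) = i) with hF
    change 0 < F.card at hpos
    change |(∑ j ∈ F, X j (a j (fun k b => X k b ω)) ω) / (F.card : ℝ) - meanReward ν i|
      < Real.sqrt (γ * L / (F.card : ℝ)) / 2
    have hnK : F.card ≤ K := by
      have := Finset.card_le_card ((Finset.filter_subset _ _).trans (hOK t ht) : F ⊆ _)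
      simpa using this
    have hk : (t, F.card, i) ∈ Finset.range K ×ˢ Finset.Icc 1 K ×ˢ (Finset.univ : Finset (Fin A)) := by
      simp only [Finset.mem_product, Finset.mem_range, Finset.mem_Icc, Finset.mem_univ]
      exact ⟨ht, ⟨hpos, hnK⟩, trivial⟩
    have h1 : ω ∉ bad t F.card i (rate F.card) ∪ bad t F.card i (-rate F.card) :=
      fun h => hnot (Set.mem_biUnion hk h)
    simp only [hbad, Set.mem_union, Set.mem_inter_iff, Set.mem_ofPred_eq, not_or, not_and] at h1
    set Z := ∑ j ∈ F, (X j i ω - meanReward ν i) with hZ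
    have h2 : rate F.card * Z < γ * L := by
      by_contra! h2
      exact h1.1 ⟨rfl, h2⟩ hωE
    have h3 : -rate F.card * Z < γ * L := by
      by_contra! h3
      exact h1.2 ⟨rfl, h3⟩ hωE
    have hn' : (0 : ℝ) < F.card := by exact_mod_cast hpos
    have h4 : (∑ j ∈ F, X j (a j (fun k b => X k b ω)) ω) / (F.card : ℝ) - meanReward ν i
        = Z / F.card := by
      have h5 : ∑ j ∈ F, X j (a j (fun k b => X k b ω)) ω = ∑ j ∈ F, X j i ω :=
        Finset.sum_congr rfl fun j hj => by rw [(Finset.mem_filter.1 hj).2]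
      rw [h5, hZ, Finset.sum_sub_distrib, Finset.sum_const, nsmul_eq_mul]
      field_simp
    rw [h4]
    set s := Real.sqrt (γ * L / (F.card : ℝ)) with hs
    have hs2 : s ^ 2 = γ * L / F.card := Real.sq_sqrt (by positivity)
    have hs0 : 0 ≤ s := Real.sqrt_nonneg _
    have h6 : γ * L = s ^ 2 * F.card := by
      rw [hs2]; field_simp
    have hr : rate F.card = 2 * s := rfl
    rw [hr, h6] at h2 h3
    -- If s = 0, the strict inequality `h2` would read 0 < 0.
    have hspos : 0 < s := by
      rcases hs0.eq_or_lt with h0 | h0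
      · rw [← h0] at h2
        simp at h2
      · exact h0
    rw [abs_lt]
    constructor
    · rw [lt_div_iff₀ hn']
      nlinarith
    · rw [div_lt_iff₀ hn']
      nlinarith
  calc P ({ω | ¬ RewardsConcentrated A K γ ν (fun j b => X j b ω) (fun j => T j ω)} ∩ E)
      ≤ P (⋃ k ∈ (Finset.range K ×ˢ Finset.Icc 1 K ×ˢ (Finset.univ : Finset (Fin A))),
        (bad k.1 k.2.1 k.2.2 (rate k.2.1) ∪ bad k.1 k.2.1 k.2.2 (-rate k.2.1))) :=
        measure_mono hsub
    _ ≤ ∑ k ∈ (Finset.range K ×ˢ Finset.Icc 1 K ×ˢ (Finset.univ : Finset (Fin A))),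
        P (bad k.1 k.2.1 k.2.2 (rate k.2.1) ∪ bad k.1 k.2.1 k.2.2 (-rate k.2.1)) :=
        measure_biUnion_finset_le _ _
    _ ≤ ∑ k ∈ (Finset.range K ×ˢ Finset.Icc 1 K ×ˢ (Finset.univ : Finset (Fin A))),
        (ENNReal.ofReal (Real.exp (-(γ / 2 * L))) * P E
          + ENNReal.ofReal (Real.exp (-(γ / 2 * L))) * P E) := by
        refine Finset.sum_le_sum fun k hk => (measure_union_le _ _).trans ?_
        simp only [Finset.mem_product, Finset.mem_range, Finset.mem_Icc] at hk
        exact add_le_add (hbound _ hk.1 _ hk.2.1.1 _ _ rfl)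
          (hbound _ hk.1 _ hk.2.1.1 _ _ (neg_sq _))
    _ = 2 * (K : ℝ≥0∞) ^ 2 * A * ENNReal.ofReal (Real.exp (-(γ / 2 * L))) * P E := by
        rw [Finset.sum_const, nsmul_eq_mul]
        simp only [Finset.card_product, Finset.card_range, Nat.card_Icc, Nat.add_sub_cancel,
          Finset.card_univ, Fintype.card_fin]
        push_cast
        ring

end Rewards

/-! ### Regret bounds -/

lemma regret_nonneg {Ω : Type*} {A : ℕ} [NeZero A] (alg : MultiBatchedAlgorithm A) (ν : Fin A → Measure ℝ)
    (X : ℕ → Fin A → Ω → ℝ) (T : ℕ → Ω → ℕ) (K : ℕ) (ω : Ω) : 0 ≤ regret alg ν X T K ω :=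
  Finset.sum_nonneg fun _ _ => gap_nonneg ν _

lemma regret_le {Ω : Type*} {A : ℕ} [NeZero A] (alg : MultiBatchedAlgorithm A)
    {ν : Fin A → Measure ℝ} {X : ℕ → Fin A → Ω → ℝ} {T : ℕ → Ω → ℕ}
    (hν : ∀ i, 0 ≤ meanReward ν i ∧ meanReward ν i ≤ 1) (K : ℕ) (ω : Ω) :
    regret alg ν X T K ω ≤ K :=
  (Finset.sum_le_sum fun _ _ => gap_le_one hν _).trans_eq (by simp)

section RegretBounds

variable {Ω : Type*} [MeasurableSpace Ω] {P : Measure Ω} {A : ℕ} {ν : Fin A → Measure ℝ}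
  {ρ : Measure ℕ} {X : ℕ → Fin A → Ω → ℝ} {T : ℕ → Ω → ℕ}

/-- The arm of round t depends on the delays only through the first t of them, which take countably
many values; on each fibre the fixed-delay result applies. -/
lemma measurable_regret [NeZero A] (h : IsEnvironment P ν ρ X T) (K : ℕ) (γ : ℝ) :
    Measurable (regret (BaSE A K γ) ν X T K) := by
  refine Finset.measurable_fun_sum _ fun t _ => ?_
  refine (measurable_of_countable (gap ν)).comp (measurable_to_countable' fun i => ?_)
  set ext : (Fin t → ℕ) → ℕ → ℕ := fun d₀ j => if hj : j < t then d₀ ⟨j, hj⟩ else 0 with hext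
  have hX : Measurable fun ω => fun j b => X j b ω :=
    measurable_pi_iff.2 fun j => measurable_pi_iff.2 fun b => h.measurable_reward j b
  have h1 : (fun ω => (BaSE A K γ).pulledArm (fun j a => X j a ω) (fun j => T j ω) t) ⁻¹' {i}
      = ⋃ d₀ : Fin t → ℕ, (fun ω => fun j : Fin t => T j ω) ⁻¹' {d₀} ∩
        (fun ω => (BaSE A K γ).pulledArm (fun j a => X j a ω) (ext d₀) t) ⁻¹' {i} := by
    ext ω
    simp only [Set.mem_preimage, Set.mem_singleton_iff, Set.mem_iUnion, Set.mem_inter_iff,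
      exists_eq_left']
    rw [(BaSE A K γ).pulledArm_congr (fun _ _ => rfl)
      (d' := ext fun j : Fin t => T j ω) fun j hj => by simp only [hext, dif_pos hj]]
  rw [h1]
  exact MeasurableSet.iUnion fun d₀ =>
    (measurable_truncated_delay h t (measurableSet_singleton d₀)).inter
      (((measurable_pulledArm K γ (ext d₀) t).comp hX) (measurableSet_singleton i))

variable [IsProbabilityMeasure P] {R : Ω → ℝ} {K : ℕ} {B : ℝ}

lemma regretBound_of_forall_le (hR : Measurable R) (h0 : ∀ ω, 0 ≤ R ω) (hB : ∀ ω, R ω ≤ B) :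
    RegretBound P R K B := by
  have hint : Integrable R P := Integrable.of_mem_Icc 0 B hR.aemeasurable
    (.of_forall fun ω => ⟨h0 ω, hB ω⟩)
  refine ⟨⟨hint, ?_⟩, ?_⟩
  · calc ∫ ω, R ω ∂P ≤ ∫ _, B ∂P := integral_mono hint (integrable_const _) hB
      _ = B := by simp
  · have : {ω | R ω ≤ B} = Set.univ := Set.eq_univ_of_forall hB
    rw [this, probReal_univ]
    have : 0 ≤ 1 / (K : ℝ) := by positivity
    linarith

lemma RegretBound.mono {B' : ℝ} (h : RegretBound P R K B) (hB : B ≤ B') : RegretBound P R K B' :=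
  ⟨⟨h.1.1, h.1.2.trans hB⟩, h.2.trans (measureReal_mono fun _ hω => le_trans hω hB)⟩

/-- The bad event costs at most K · (1/K) = 1 in expectation. -/
lemma regretBound_of_bad_event (hK : 0 < K) (hR : Measurable R) (h0 : ∀ ω, 0 ≤ R ω)
    (hRK : ∀ ω, R ω ≤ K) {bad : Set Ω} (hbad : P.real bad ≤ 1 / K) (hB : 0 ≤ B)
    (hgood : ∀ ω ∉ bad, R ω ≤ B) : RegretBound P R K (B + 1) := by
  have hK' : (0 : ℝ) < K := by exact_mod_cast hK
  have hint : Integrable R P := Integrable.of_mem_Icc 0 K hR.aemeasurable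
    (.of_forall fun ω => ⟨h0 ω, hRK ω⟩)
  have hm : MeasurableSet {ω | R ω ≤ B} := measurableSet_le hR measurable_const
  have hc : P.real {ω | R ω ≤ B}ᶜ ≤ 1 / K :=
    (measureReal_mono fun ω hω => by
      by_contra h
      exact hω (hgood ω h)).trans hbad
  refine ⟨⟨hint, ?_⟩, ?_⟩
  · calc ∫ ω, R ω ∂P ≤ ∫ ω, B + Set.indicator {ω | R ω ≤ B}ᶜ (fun _ => (K : ℝ)) ω ∂P := by
          refine integral_mono hint ((integrable_const _).add
            ((integrable_const _).indicator hm.compl)) fun ω => ?_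
          by_cases hω : R ω ≤ B
          · have h1 : ω ∉ {ω | R ω ≤ B}ᶜ := fun h => h hω
            rwa [Set.indicator_of_notMem h1, add_zero]
          · have h1 : ω ∈ {ω | R ω ≤ B}ᶜ := hω
            rw [Set.indicator_of_mem h1]
            linarith [hRK ω]
      _ = B + P.real {ω | R ω ≤ B}ᶜ * K := by
          rw [integral_add (integrable_const _) ((integrable_const _).indicator hm.compl),
            integral_indicator_const _ hm.compl]
          simp
      _ ≤ B + 1 / K * K := by gcongr
      _ = B + 1 := by field_simp
  · have h1 : P.real {ω | R ω ≤ B} = 1 - P.real {ω | R ω ≤ B}ᶜ := by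
      rw [probReal_compl_eq_one_sub hm]; ring
    have h2 : P.real {ω | R ω ≤ B} ≤ P.real {ω | R ω ≤ B + 1} :=
      measureReal_mono fun ω hω => (show R ω ≤ B from hω).trans (by linarith)
    linarith

lemma const_le_log_of_two_le {K : ℕ} (hK : 2 ≤ K) : 0.69 ≤ Real.log (K : ℝ) := by
  have h1 : Real.log 2 ≤ Real.log (K : ℝ) :=
    Real.log_le_log two_pos (by exact_mod_cast hK)
  linarith [Real.log_two_gt_d9]

lemma numBatches_le {K : ℕ} (hK : 2 ≤ K) : (numBatches K : ℝ) ≤ 3 * Real.log K := by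
  have h1 : 2 ^ (numBatches K - 1) < K := Nat.pow_pred_clog_lt_self one_lt_two hK
  have h2 : ((2 : ℝ) ^ (numBatches K - 1)) ≤ K := by exact_mod_cast h1.le
  have h3 := Real.log_le_log (by positivity) h2
  rw [Real.log_pow, Nat.cast_sub (numBatches_pos hK)] at h3
  have h4 := Real.log_two_gt_d9
  have h5 : (1 : ℝ) ≤ numBatches K := by exact_mod_cast numBatches_pos hK
  have h6 := const_le_log_of_two_le hK
  push_cast at h3
  nlinarith

/-- The first two events have probability at most 2/K⁴ each, by γ/2 ≥ 6 and l = 8 log K, and G at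
most 1/K⁶. Each of 4/K⁴ and 1/K⁶ is at most 1/(2K). -/
lemma IsEnvironment.measureReal_bad_le [NeZero A] (h : IsEnvironment P ν ρ X T)
    (hν : ∀ a, ν a (Set.Icc (0 : ℝ) 1)ᶜ = 0) {γ : ℝ} (hγ : 12 ≤ γ) (hK : 2 ≤ K) {G : Set Ω}
    (hG : P.real G ≤ (K : ℝ) ^ 2 * Real.exp (-(8 * Real.log K))) :
    P.real (({ω | ¬ RewardsConcentrated A K γ ν (fun j b => X j b ω) (fun j => T j ω)}
      ∪ {ω | ¬ ArrivalsBalanced K (5 * (8 * Real.log K) + 2) (fun j => T j ω)}) ∪ G)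
      ≤ 1 / K := by
  have hk : (2 : ℝ) ≤ K := by exact_mod_cast hK
  have hA : (1 : ℝ) ≤ A := by exact_mod_cast NeZero.one_le
  have hk0 : (0 : ℝ) < K := by linarith
  have hL := log_mul_nonneg A K
  have he : Real.exp (-(8 * Real.log K)) = ((K : ℝ) ^ 8)⁻¹ := by
    rw [Real.exp_neg, mul_comm, Real.exp_mul, Real.exp_log hk0]
    norm_cast
  have h1 : P.real {ω | ¬ RewardsConcentrated A K γ ν (fun j b => X j b ω) (fun j => T j ω)}
      ≤ 2 / (K : ℝ) ^ 4 := by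
    have h2 := ENNReal.toReal_mono (by finiteness)
      (measure_not_rewardsConcentrated_le h hν (by linarith : 0 ≤ γ) K)
    refine h2.trans ?_
    rw [ENNReal.toReal_mul, ENNReal.toReal_ofReal (Real.exp_nonneg _)]
    simp only [ENNReal.toReal_mul, ENNReal.toReal_pow, ENNReal.toReal_natCast, ENNReal.toReal_ofNat]
    have h3 : Real.exp (-(γ / 2 * Real.log ((K : ℝ) * A))) ≤ (((K : ℝ) * A) ^ 6)⁻¹ := by
      have h4 : (((K : ℝ) * A) ^ 6)⁻¹ = Real.exp (-(6 * Real.log ((K : ℝ) * A))) := by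
        rw [Real.exp_neg, mul_comm 6, Real.exp_mul, Real.exp_log (by positivity)]
        norm_cast
      rw [h4, Real.exp_le_exp]
      nlinarith
    calc 2 * (K : ℝ) ^ 2 * A * Real.exp (-(γ / 2 * Real.log ((K : ℝ) * A)))
        ≤ 2 * (K : ℝ) ^ 2 * A * (((K : ℝ) * A) ^ 6)⁻¹ := by gcongr
      _ = 2 / (K : ℝ) ^ 4 / A ^ 5 := by field_simp
      _ ≤ 2 / (K : ℝ) ^ 4 := div_le_self (by positivity) (one_le_pow₀ hA)
  have h2 : P.real {ω | ¬ ArrivalsBalanced K (5 * (8 * Real.log K) + 2) (fun j => T j ω)}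
      ≤ 2 / (K : ℝ) ^ 4 := by
    refine (measureReal_not_arrivalsBalanced_le h.measurable_delay h.law_delay h.iIndepFun_delay K
      (8 * Real.log K)).trans_eq ?_
    rw [he]
    field_simp
  rw [he] at hG
  have h3 : (K : ℝ) ^ 2 * ((K : ℝ) ^ 8)⁻¹ = 1 / (K : ℝ) ^ 6 := by field_simp
  have h4 : 4 / (K : ℝ) ^ 4 ≤ 1 / (2 * K) := by
    rw [div_le_div_iff₀ (by positivity) (by positivity)]
    have : (8 : ℝ) ≤ (K : ℝ) ^ 3 := by
      calc (8 : ℝ) = 2 ^ 3 := by norm_num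
        _ ≤ (K : ℝ) ^ 3 := by gcongr
    nlinarith
  have h5 : 1 / (K : ℝ) ^ 6 ≤ 1 / (2 * K) := by
    have : (2 : ℝ) ≤ (K : ℝ) ^ 5 := by
      calc (2 : ℝ) ≤ 2 ^ 5 := by norm_num
        _ ≤ (K : ℝ) ^ 5 := by gcongr
    apply one_div_le_one_div_of_le (by positivity)
    nlinarith
  have h6 : 1 / (2 * (K : ℝ)) + 1 / (2 * K) = 1 / K := by field_simp; norm_num
  have h7 : 2 / (K : ℝ) ^ 4 + 2 / (K : ℝ) ^ 4 = 4 / (K : ℝ) ^ 4 := by ring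
  refine (measureReal_union_le _ _).trans ((add_le_add_left (measureReal_union_le _ _) _).trans ?_)
  linarith

variable [NeZero A] {γ : ℝ}

/-- The regret bound in terms of an upper bound, outside a rare event, on the time at which the
batches end. -/
lemma IsEnvironment.regretBound_of_time_le (h : IsEnvironment P ν ρ X T)
    (hν : ∀ a, ν a (Set.Icc (0 : ℝ) 1)ᶜ = 0) (hγ : 12 ≤ γ) (hK : 2 ≤ K) (hAK : A ≤ K)
    (hpos : 0 < minGap ν) {G : Set Ω}
    (hG : P.real G ≤ (K : ℝ) ^ 2 * Real.exp (-(8 * Real.log K))) {a c : ℝ} (ha : 0 ≤ a)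
    (hc : 0 ≤ c) (ht : ∀ ω ∉ G, ∀ t < K, (t : ℝ) ≤ a * 2 ^ (((BaSE A K γ).state
      (fun j b => X j b ω) (fun j => T j ω) t).hist.length + 1) + c) :
    RegretBound P (regret (BaSE A K γ) ν X T K) K
      (c + 3 + 8 * (32 * γ + 43) * a * (A * Real.log K / minGap ν)) := by
  have hmean := h.meanReward_mem hν
  have hk : (2 : ℝ) ≤ K := by exact_mod_cast hK
  have hA : (1 : ℝ) ≤ A := by exact_mod_cast NeZero.one_le
  have hAK' : (A : ℝ) ≤ K := by exact_mod_cast hAK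
  have hlog := const_le_log_of_two_le hK
  have hL : Real.log ((K : ℝ) * A) ≤ 2 * Real.log K := by
    rw [Real.log_mul (by positivity) (by positivity)]
    have := Real.log_le_log (by linarith) hAK'
    linarith
  have hL0 := log_mul_nonneg A K
  have hγ0 : 0 ≤ γ := by linarith
  refine (regretBound_of_bad_event (B := c + 2 + 8 * (32 * γ + 43) * a * (A * Real.log K / minGap ν))
    (by omega) (measurable_regret h K γ)
    (regret_nonneg _ ν X T K) (regret_le _ hmean K) (h.measureReal_bad_le hν hγ hK hG)
    (by positivity) fun ω hω => ?_).mono (by linarith)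
  simp only [Set.mem_union, Set.mem_ofPred_eq, not_or, not_not] at hω
  obtain ⟨⟨h1, h2⟩, h3⟩ := hω
  refine (sum_gap_le hγ0 hK hAK (by linarith) h1 h2 hmean hpos ha hc (ht ω h3)).trans ?_
  -- Here log(KA) ≤ 2 log K since A ≤ K, and 2 ≤ 3 log K turns 40 log K + 2 into 43 log K.
  have h4 : 16 * γ * Real.log ((K : ℝ) * A) + (5 * (8 * Real.log K) + 2)
      ≤ (32 * γ + 43) * Real.log K := by nlinarith
  have h5 : 2 * (a * (4 * A * (16 * γ * Real.log ((K : ℝ) * A) + (5 * (8 * Real.log K) + 2)))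
      / minGap ν) ≤ 2 * (a * (4 * A * ((32 * γ + 43) * Real.log K)) / minGap ν) := by gcongr
  have h6 : 2 * (a * (4 * A * ((32 * γ + 43) * Real.log K)) / minGap ν)
      = 8 * (32 * γ + 43) * a * (A * Real.log K / minGap ν) := by ring
  linarith

/-! ### Quantiles of the delays and the two regret bounds -/

lemma le_delayQuantile_measure [IsProbabilityMeasure ρ] {q : ℝ} (hq : q < 1) :
    q ≤ ρ.real (Set.Iic (delayQuantile ρ q)) := by
  have hne : {n : ℕ | q ≤ ρ.real (Set.Iic n)}.Nonempty := by
    have h1 : Filter.Tendsto (fun n : ℕ => ρ.real (Set.Iic n)) Filter.atTop (nhds 1) := by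
      have h2 := tendsto_measure_iUnion_atTop (μ := ρ) (s := fun n : ℕ => Set.Iic n)
        (fun _ _ h => Set.Iic_subset_Iic.2 h)
      have h3 : ⋃ n : ℕ, Set.Iic n = Set.univ := Set.iUnion_eq_univ_iff.2 fun n => ⟨n, Set.mem_Iic.2 le_rfl⟩
      rw [h3, measure_univ] at h2
      have h4 := (ENNReal.tendsto_toReal ENNReal.one_ne_top).comp h2
      rwa [ENNReal.toReal_one] at h4
    obtain ⟨n, hn⟩ := (h1.eventually (eventually_ge_nhds hq)).exists
    exact ⟨n, hn⟩
  exact Nat.sInf_mem hne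

/-- One exponential moment, at l = 1/b, dominates n; finiteness of the mean is all that the second
bound takes from subexponentiality. -/
lemma IsSubexponential.integrable [IsProbabilityMeasure ρ] {v b : ℝ} (h : IsSubexponential ρ v b) :
    Integrable (fun n : ℕ => (n : ℝ)) ρ := by
  obtain ⟨-, hb, h⟩ := h
  have h1 := (h (1 / b) (by rw [abs_of_pos (by positivity)])).1
  refine (h1.const_mul (b * Real.exp (1 / b * meanDelay ρ))).mono'
    (measurable_of_countable _).aestronglyMeasurable (.of_forall fun n => ?_)
  rw [Real.norm_eq_abs, abs_of_nonneg (Nat.cast_nonneg n), mul_assoc, ← Real.exp_add]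
  have h2 := Real.add_one_le_exp (1 / b * n)
  have h3 : 1 / b * meanDelay ρ + 1 / b * (n - meanDelay ρ) = 1 / b * (n : ℝ) := by ring
  rw [h3]
  calc (n : ℝ) = b * (1 / b * n) := by field_simp
    _ ≤ b * Real.exp (1 / b * n) := by gcongr; linarith

/-- By minimality the delay is at least u with probability above 1/2; apply Markov's inequality. -/
lemma delayQuantile_half_le [IsProbabilityMeasure ρ] (h : Integrable (fun n : ℕ => (n : ℝ)) ρ) :
    (delayQuantile ρ (1 / 2) : ℝ) ≤ 2 * meanDelay ρ := by
  have h0 : 0 ≤ meanDelay ρ := integral_nonneg fun n => Nat.cast_nonneg n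
  set u := delayQuantile ρ (1 / 2) with hu
  rcases Nat.eq_zero_or_pos u with h1 | h1
  · rw [h1]; simpa using h0
  have h2 : ¬ 1 / 2 ≤ ρ.real (Set.Iic (u - 1)) := fun hmem =>
    absurd (Nat.sInf_le (s := {n : ℕ | 1 / 2 ≤ ρ.real (Set.Iic n)}) hmem)
      (by rw [← delayQuantile, ← hu]; omega)
  have h3 : {n : ℕ | (u : ℝ) ≤ n} = (Set.Iic (u - 1))ᶜ := by
    ext n
    simp only [Set.mem_ofPred_eq, Nat.cast_le, Set.mem_compl_iff, Set.mem_Iic]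
    omega
  have h4 := mul_meas_ge_le_integral_of_nonneg (μ := ρ)
    (.of_forall fun n : ℕ => (Nat.cast_nonneg n : (0 : ℝ) ≤ n)) h (u : ℝ)
  rw [h3, probReal_compl_eq_one_sub measurableSet_Iic] at h4
  have h5 : (0 : ℝ) < u := by exact_mod_cast h1
  have h6 : ∫ n : ℕ, (n : ℝ) ∂ρ = meanDelay ρ := rfl
  rw [h6] at h4
  nlinarith

lemma potential_le_numBatches {x : ℕ → Fin A → ℝ} {d : ℕ → ℕ} {g : ℕ → ℝ} {β : ℝ} (hK : 2 ≤ K)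
    (hβ : 0 ≤ β) (g0 : g 0 ≤ 0) (g1 : ∀ t, g (t + 1) ≤ g t + 1)
    (hg : ∀ σ e, σ ≤ e → e < K → g (e + 1) - g σ ≤ (arrived d σ e).card + β) {t : ℕ} (ht : t < K) :
    g t ≤ 2 ^ (((BaSE A K γ).state x d t).hist.length + 1) + 3 * Real.log K * (β + 1) := by
  refine (potential_le K γ x d hβ g0 g1 hg ht).trans ?_
  have h1 : (((BaSE A K γ).state x d t).hist.length : ℝ) + 1 ≤ numBatches K := by
    exact_mod_cast length_lt_numBatches γ x d hK ht
  have := h1.trans (numBatches_le hK)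
  gcongr

/-- The regret bound in terms of quantiles of the delay distribution. -/
lemma IsEnvironment.regretBound_quantile (h : IsEnvironment P ν ρ X T)
    (hν : ∀ a, ν a (Set.Icc (0 : ℝ) 1)ᶜ = 0) (hγ : 12 ≤ γ) (hK : 2 ≤ K) (hAK : A ≤ K)
    (hpos : 0 < minGap ν) {q : ℝ} (hq0 : 0 < q) (hq1 : q < 1) :
    RegretBound P (regret (BaSE A K γ) ν X T K) K
      ((32 * (32 * γ + 43) + 64) * (A * Real.log K / (q * minGap ν) + Real.log K ^ 2 / q
        + delayQuantile ρ q * Real.log K)) := by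
  have : IsProbabilityMeasure ρ :=
    h.law_delay 0 ▸ Measure.isProbabilityMeasure_map (h.measurable_delay 0).aemeasurable
  set u := delayQuantile ρ q with hu
  set k := Real.log (K : ℝ) with hk
  have hlog : 0.69 ≤ k := const_le_log_of_two_le hK
  have hqu := le_delayQuantile_measure (ρ := ρ) hq1
  set β : ℝ := q / 2 * u + 8 * k with hβ
  have hβ0 : 0 ≤ β := by positivity
  refine (h.regretBound_of_time_le (γ := γ) hν hγ hK hAK hpos
    (measureReal_not_window_le h.measurable_delay h.law_delay h.iIndepFun_delay K u hq0.le hqu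
      (8 * k))
    (a := 2 / q) (c := 2 / q * (3 * k * (β + 1))) (by positivity) (by positivity) ?_).mono ?_
  · intro ω hω t ht
    simp only [Set.mem_ofPred_eq, not_not] at hω
    have h1 := potential_le_numBatches (γ := γ) (x := fun j b => X j b ω) (d := fun j => T j ω)
      (g := fun t => q / 2 * (t : ℝ)) hK hβ0 (by simp)
      (fun t => by push_cast; linarith) (fun σ e hσ he => by
        have := hω σ (hσ.trans_lt he) e he hσ
        push_cast
        linarith) ht
    calc (t : ℝ) = 2 / q * (q / 2 * t) := by field_simp
      _ ≤ 2 / q * (2 ^ (((BaSE A K γ).state (fun j b => X j b ω)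
          (fun j => T j ω) t).hist.length + 1) + 3 * k * (β + 1)) := by gcongr
      _ = _ := by ring
  -- The multiples of k²/q are 48 from `e1`, 6 · 1.5 from `e3` and 7 from `e4`, adding up to 64.
  · have e1 : 2 / q * (3 * k * (β + 1)) = 3 * (u * k) + 48 * (k ^ 2 / q) + 6 * (k / q) := by
      rw [hβ]; field_simp; ring
    have e2 : 8 * (32 * γ + 43) * (2 / q) * (A * k / minGap ν)
        = 16 * (32 * γ + 43) * (A * k / (q * minGap ν)) := by field_simp; ring
    have e3 : k / q ≤ 1.5 * (k ^ 2 / q) := by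
      rw [← mul_div_assoc]
      gcongr
      nlinarith
    have e4 : 3 ≤ 7 * (k ^ 2 / q) := by
      rw [← mul_div_assoc, le_div_iff₀ hq0]
      nlinarith
    have p1 : 0 ≤ (u : ℝ) * k := by positivity
    have p2 : 0 ≤ A * k / (q * minGap ν) := by positivity
    have p3 : 0 ≤ k ^ 2 / q := by positivity
    rw [e1, e2]
    nlinarith [mul_nonneg (by linarith : 0 ≤ γ) p1, mul_nonneg (by linarith : 0 ≤ γ) p2,
      mul_nonneg (by linarith : 0 ≤ γ) p3]

/-- The regret bound in terms of the expected delay. -/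
lemma IsEnvironment.regretBound_mean (h : IsEnvironment P ν ρ X T)
    (hν : ∀ a, ν a (Set.Icc (0 : ℝ) 1)ᶜ = 0) (hγ : 12 ≤ γ) (hK : 2 ≤ K) (hAK : A ≤ K)
    (hpos : 0 < minGap ν) (hle : minGap ν ≤ 1) (hint : Integrable (fun n : ℕ => (n : ℝ)) ρ) :
    RegretBound P (regret (BaSE A K γ) ν X T K) K
      ((32 * (32 * γ + 43) + 64) * (A * Real.log K / minGap ν + meanDelay ρ * Real.log K)) := by
  have : IsProbabilityMeasure ρ :=
    h.law_delay 0 ▸ Measure.isProbabilityMeasure_map (h.measurable_delay 0).aemeasurable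
  set u := delayQuantile ρ (1 / 2) with hu
  set k := Real.log (K : ℝ) with hk
  have hlog : 0.69 ≤ k := const_le_log_of_two_le hK
  have hqu := le_delayQuantile_measure (ρ := ρ) one_half_lt_one
  have hk2 : (2 : ℝ) ≤ K := by exact_mod_cast hK
  have hA : (1 : ℝ) ≤ A := by exact_mod_cast NeZero.one_le
  have hG : P.real {ω | ¬ ∀ t < K, 1 / 2 / 2 * (t : ℝ) - 8 * k
      ≤ (((Finset.range t).filter (fun j => T j ω ≤ u)).card : ℝ)}
      ≤ (K : ℝ) ^ 2 * Real.exp (-(8 * k)) := by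
    refine (measureReal_not_prefix_le h.measurable_delay h.law_delay h.iIndepFun_delay K u hqu
      (8 * k)).trans ?_
    gcongr
    nlinarith
  refine (h.regretBound_of_time_le (γ := γ) hν hγ hK hAK hpos hG
    (a := 4) (c := 4 * (3 * k * (u + 1) + 8 * k)) (by positivity) (by positivity) ?_).mono ?_
  · intro ω hω t ht
    simp only [Set.mem_ofPred_eq, not_not] at hω
    have h1 := potential_le_numBatches (γ := γ) (x := fun j b => X j b ω) (d := fun j => T j ω)
      (g := fun t => (((Finset.range t).filter (fun j => T j ω ≤ u)).card : ℝ)) (β := u) hK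
      (Nat.cast_nonneg u) (by simp)
      (fun t => by
        have : ((Finset.range (t + 1)).filter (fun j => T j ω ≤ u)).card
            ≤ ((Finset.range t).filter (fun j => T j ω ≤ u)).card + 1 := by
          rw [Finset.range_add_one, Finset.filter_insert]
          split_ifs
          · exact Finset.card_insert_le _ _
          · exact Nat.le_succ _
        exact_mod_cast this)
      (fun σ e hσ he => by
        -- A round of the window with delay at most u has arrived by time e or is among the last u
        -- rounds. This holds surely, so no logarithm is lost per window.
        have : (Finset.range (e + 1)).filter (fun j => T j ω ≤ u)
            ⊆ ((Finset.range σ).filter (fun j => T j ω ≤ u) ∪ arrived (fun j => T j ω) σ e)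
              ∪ Finset.Ico (e + 1 - u) (e + 1) := by
          intro j hj
          simp only [Finset.mem_filter, Finset.mem_range, Finset.mem_union, arrived,
            Finset.mem_Icc, Finset.mem_Ico] at hj ⊢
          omega
        have h2 := Finset.card_le_card this
        have h3 := Finset.card_union_le ((Finset.range σ).filter (fun j => T j ω ≤ u)
          ∪ arrived (fun j => T j ω) σ e) (Finset.Ico (e + 1 - u) (e + 1))
        have h4 := Finset.card_union_le ((Finset.range σ).filter (fun j => T j ω ≤ u))
          (arrived (fun j => T j ω) σ e)
        have h5 : (Finset.Ico (e + 1 - u) (e + 1)).card ≤ u := by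
          rw [Nat.card_Ico]; omega
        rw [sub_le_iff_le_add]
        exact_mod_cast (by omega)) ht
    have h2 := hω t ht
    linarith
  · have e1 := delayQuantile_half_le hint
    rw [← hu] at e1
    have e2 : k ≤ A * k / minGap ν := by
      rw [le_div_iff₀ hpos]
      nlinarith
    have e3 : (u : ℝ) * k ≤ 2 * meanDelay ρ * k := by gcongr
    have p1 : 0 ≤ meanDelay ρ * k :=
      mul_nonneg (integral_nonneg fun n => Nat.cast_nonneg n) (by linarith)
    have p2 : 0 ≤ A * k / minGap ν := by positivity
    nlinarith [mul_nonneg (by linarith : 0 ≤ γ) p1, mul_nonneg (by linarith : 0 ≤ γ) p2]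

end RegretBounds

end DelayedBandit

end

/-! ### The main theorem -/

open DelayedBandit in
theorem mainTheorem12 (γ : ℝ) (hγ : 12 ≤ γ) :
    ∃ C : ℝ, 0 < C ∧
      ∀ (Ω : Type*) [MeasurableSpace Ω] (P : Measure Ω) [IsProbabilityMeasure P]
        (A K : ℕ) [NeZero A] (_ : 2 ≤ K)
        (ν : Fin A → Measure ℝ) (_ : ∀ a, ν a (Set.Icc (0 : ℝ) 1)ᶜ = 0)
        (ρ : Measure ℕ) (X : ℕ → Fin A → Ω → ℝ) (T : ℕ → Ω → ℕ)
        (_ : DelayedBandit.IsEnvironment P ν ρ X T),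
        (∀ q : ℝ, 0 < q → q < 1 →
          DelayedBandit.RegretBound P
            (DelayedBandit.regret (DelayedBandit.BaSE A K γ) ν X T K) K
            (C * ((A : ℝ) * Real.log K / (q * DelayedBandit.minGap ν)
              + Real.log K ^ 2 / q
              + (DelayedBandit.delayQuantile ρ q : ℝ) * Real.log K))) ∧
        (∀ v b : ℝ, DelayedBandit.IsSubexponential ρ v b →
          DelayedBandit.RegretBound P
            (DelayedBandit.regret (DelayedBandit.BaSE A K γ) ν X T K) K
            (C * ((A : ℝ) * Real.log K / DelayedBandit.minGap ν
              + DelayedBandit.meanDelay ρ * Real.log K))) := by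
  refine ⟨32 * (32 * γ + 43) + 64, by linarith, ?_⟩
  intro Ω _ P _ A K _ hK ν hν ρ X T h
  have hmean := h.meanReward_mem hν
  have : IsProbabilityMeasure ρ :=
    h.law_delay 0 ▸ Measure.isProbabilityMeasure_map (h.measurable_delay 0).aemeasurable
  have hlog := const_le_log_of_two_le hK
  have hmd : 0 ≤ meanDelay ρ := integral_nonneg fun n => Nat.cast_nonneg n
  have hmin := minGap_nonneg ν
  have hγ0 : 0 ≤ γ := by linarith
  by_cases hgap : ∀ i, gap ν i = 0
  · have hR : ∀ ω, regret (BaSE A K γ) ν X T K ω = 0 := fun ω =>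
      Finset.sum_eq_zero fun t _ => hgap _
    refine ⟨fun q hq0 _ => ?_, fun v b _ => ?_⟩ <;>
    refine regretBound_of_forall_le (measurable_regret h K γ) (regret_nonneg _ ν X T K)
      fun ω => (hR ω).trans_le ?_
    · positivity
    · positivity
  push Not at hgap
  obtain ⟨i, hi⟩ := hgap
  have hi0 : 0 < gap ν i := (gap_nonneg ν i).lt_of_ne' hi
  have hpos : 0 < minGap ν := minGap_pos hi0
  have hle : minGap ν ≤ 1 := (minGap_le hi0).trans (gap_le_one hmean i)
  -- Balanced arrivals control moduli up to K only, hence the case A ≤ K; otherwise K ≤ A makes the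
  -- trivial regret bound sufficient.
  rcases le_total A K with hAK | hKA
  · exact ⟨fun q hq0 hq1 => h.regretBound_quantile hν hγ hK hAK hpos hq0 hq1,
      fun v b hsub => h.regretBound_mean hν hγ hK hAK hpos hle hsub.integrable⟩
  · have hAK' : (K : ℝ) ≤ A := by exact_mod_cast hKA
    have hA0 : (0 : ℝ) ≤ A := Nat.cast_nonneg A
    have key : ∀ δ : ℝ, 0 < δ → δ ≤ 1 →
        (K : ℝ) ≤ (32 * (32 * γ + 43) + 64) * (A * Real.log K / δ) := by
      intro δ h0 h1
      rw [← mul_div_assoc, le_div_iff₀ h0]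
      have h2 : (K : ℝ) * δ ≤ A * 1 := mul_le_mul hAK' h1 h0.le hA0
      have h3 : (1 : ℝ) ≤ (32 * (32 * γ + 43) + 64) * Real.log K := by nlinarith
      nlinarith
    refine ⟨fun q hq0 hq1 => ?_, fun v b _ => ?_⟩ <;>
    refine regretBound_of_forall_le (measurable_regret h K γ) (regret_nonneg _ ν X T K)
      fun ω => (regret_le _ hmean K ω).trans ?_
    · refine (key (q * minGap ν) (by positivity) (by nlinarith)).trans ?_
      gcongr
      have : 0 ≤ Real.log (K : ℝ) ^ 2 / q + (delayQuantile ρ q : ℝ) * Real.log K := by positivity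
      linarith
    · refine (key (minGap ν) hpos hle).trans ?_
      gcongr
      have : 0 ≤ meanDelay ρ * Real.log K := by positivity
      linarith
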